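/- \textbf{Conventions.} A digraph $D$ may have loops and parallel edges. For vertices $x,y$ let $d(x,y)\in\mathbb N\cup\{\infty\}$ be the length of a shortest directed path from $x$ to $y$ ($\infty$ if there is none); the out-degree of $x$ is $|\{y: d(x,y)=1\}|$, its in-degree is $|\{y : d(y,x)=1\}|$, and $D$ is locally finite if all in- and out-degrees are finite. A directed path from $x$ to $y$ is a geodesic if its length is $d(x,y)$. Put $\mathcal B^+_r(x)=\{y: d(x,y)\le r\}$ and $\mathcal B^-_r(x)=\{y: d(y,x)\le r\}$. $D$ is hyperbolic if there is $\delta\ge 0$ such that for all vertices $x,y,z$, every geodesic $P$ from $x$ to $y$, every geodesic $Q$ between $x$ and $z$ and every geodesic $R$ between $y$ and $z$ ($Q$ and $R$ each in either direction), every vertex of $P$ lies in $\mathcal B^+_\delta(q)$ for some vertex $q$ of $Q$ or in $\mathcal B^-_\delta(r)$ for some vertex $r$ of $R$. $D$ satisfies (B1) if there is a function $g$ such that for all $x$, all $r\ge 0$ and all $y,z\in\mathcal B_r^+(x)$ either $d(y,z)=\infty$ or $d(y,z)\le g(r)$; (B2) is the same condition with $\mathcal B^-_r(x)$ in place of $\mathcal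 B^+_r(x)$. A map $f\colon V(D_1)\to V(D_2)$ is a quasi-isometry if there are $\gamma\ge1$ and $c\ge0$ such that $\gamma^{-1}d(x,x')-c\le d(f(x),f(x'))\le\gamma d(x,x')+c$ for all $x,x'\in V(D_1)$ and such that for every $y\in V(D_2)$ there is $x\in V(D_1)$ with $d(f(x),y)\le c$ and $d(y,f(x))\le c$. A geodesic ray (anti-ray) is a sequence of distinct vertices $x_0,x_1,\dots$ with edges from $x_i$ to $x_{i+1}$ (from $x_{i+1}$ to $x_i$) all of whose finite directed subpaths are geodesics. For sequences $R,S$ of vertices write $R\le S$ if there is $M\ge 0$ such that for every $r\ge 0$ and every vertex $x$ there is a directed path of length at most $M$ from a vertex of $R$ to a vertex of $S$ none of whose vertices lies in $\mathcal B^+_r(x)\cup\mathcal B^-_r(x)$; write $R\approx S$ if $R\le S$ and $S\le R$. In a hyperbolic digraph with (B1) and (B2), $\le$ is a quasiorder on the set of geodesic rays and anti-rays. The geodesic boundary is the set of $\approx$-classes of geodesic rays and anti-rays; the geodesic f-boundary (b-boundary) is the set of $\approx$-classes of geodesic rays (anti-rays) only. Each of the three is ordered by the order that $\le$ induces on classes.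 \textbf{Theorem.} Let $f$ be a quasi-isometry between hyperbolic digraphs $D_1$ and $D_2$ that satisfy (B1) and (B2). (i) If all vertices of $D_1$ and $D_2$ have finite out-degree, then $f$ canonically defines an order-preserving bijection $F$ between the geodesic f-boundaries of $D_1$ and $D_2$. (ii) If all vertices of $D_1$ and $D_2$ have finite in-degree, then $f$ canonically defines an order-preserving bijection $F$ between the geodesic b-boundaries. (iii) If $D_1$ and $D_2$ are locally finite, then $f$ canonically defines an order-preserving bijection $F$ between the geodesic boundaries. Here ``order-preserving'' means that $\eta\le\mu$ if and only if $F(\eta)\le F(\mu)$, and ``canonically'' means that $F$ sends the class of $R$ to the class consisting of all geodesic rays in case (i), all geodesic anti-rays in case (ii), and all geodesic rays and anti-rays in case (iii), $S$ of $D_2$ with $f(R)\approx S$, where $f(R)$ is the sequence of images of the vertices of $R$. -/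

import Mathlib

open scoped NNReal ENNReal

namespace HypDigraph

section Semimetric

variable {X Y : Type*}

/-- The out-ball of radius `r` around `x` for an asymmetric distance `d`. -/
def outBall (d : X → X → ℝ≥0∞) (r : ℝ≥0) (x : X) : Set X := {y | d x y ≤ r}

/-- The in-ball of radius `r` around `x`. -/
def inBall (d : X → X → ℝ≥0∞) (r : ℝ≥0) (x : X) : Set X := {y | d y x ≤ r}

/-- Property (B1): distances between points of an out-ball of radius `r` are infinite or
bounded in terms of `r` only. -/
def B1 (d : X → X → ℝ≥0∞) : Prop :=
  ∃ f : ℝ≥0 → ℝ≥0, ∀ (x : X) (r : ℝ≥0), ∀ y ∈ outBall d r x, ∀ z ∈ outBall d r x,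
    d y z = ∞ ∨ d y z ≤ f r

/-- Property (B2): the same for in-balls. -/
def B2 (d : X → X → ℝ≥0∞) : Prop :=
  ∃ f : ℝ≥0 → ℝ≥0, ∀ (x : X) (r : ℝ≥0), ∀ y ∈ inBall d r x, ∀ z ∈ inBall d r x,
    d y z = ∞ ∨ d y z ≤ f r

/-- `f` is a `(γ, c)`-quasi-isometry for some `γ ≥ 1` and `c ≥ 0`: a quasi-isometric embedding
such that every point of `Y` is within `c`, in both directions, of some point `f x`. -/
def IsQuasiIsometry (dX : X → X → ℝ≥0∞) (dY : Y → Y → ℝ≥0∞) (f : X → Y) : Prop :=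
  ∃ γ c : ℝ≥0, 1 ≤ γ ∧
    (∀ x x' : X, ((γ⁻¹ : ℝ≥0) : ℝ≥0∞) * dX x x' ≤ dY (f x) (f x') + c ∧
      dY (f x) (f x') ≤ γ * dX x x' + c) ∧
    ∀ y : Y, ∃ x : X, dY (f x) y ≤ c ∧ dY y (f x) ≤ c

end Semimetric

section Digraph

/-! A digraph, with loops and parallel edges allowed, is a `Quiver` on its vertex type. -/

variable {V : Type*} [Quiver V]

/-- There is an edge from `x` to `y`. -/
def Adj (x y : V) : Prop := Nonempty (x ⟶ y)

/-- `p 0, p 1, …, p n` is a directed path of length `n` (later values of `p` are ignored). -/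
def IsDirectedPath (n : ℕ) (p : ℕ → V) : Prop := ∀ i < n, Adj (p i) (p (i + 1))

/-- The length of a shortest directed path from `x` to `y`, and `∞` if there is none. -/
noncomputable def ddist (x y : V) : ℝ≥0∞ :=
  ⨅ (n : ℕ) (_ : ∃ p : ℕ → V, IsDirectedPath n p ∧ p 0 = x ∧ p n = y), (n : ℝ≥0∞)

/-- The directed path `p 0, …, p n` is a geodesic. -/
def IsGeodesic (n : ℕ) (p : ℕ → V) : Prop :=
  IsDirectedPath n p ∧ ddist (p 0) (p n) = n

/-- The path `p 0, …, p n` is a side between `x` and `y`, in one of the two directions. -/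
def IsBetween (n : ℕ) (p : ℕ → V) (x y : V) : Prop :=
  (p 0 = x ∧ p n = y) ∨ (p 0 = y ∧ p n = x)

variable (V) in
/-- All geodesic triangles are `δ`-thin: for a geodesic triangle with end points `x, y, z`, whose
side `P` goes from `x` to `y`, whose side `Q` is between `x` and `z` and whose side `R` is
between `y` and `z`, the side `P` lies in the union of the out-ball of radius `δ` around `Q` and
the in-ball of radius `δ` around `R`. -/
def IsDeltaHyperbolic (δ : ℝ≥0) : Prop :=
  ∀ (x y z : V) (k l m : ℕ) (P Q R : ℕ → V),
    IsGeodesic k P → IsGeodesic l Q → IsGeodesic m R →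
    P 0 = x → P k = y → IsBetween l Q x z → IsBetween m R y z →
    ∀ i ≤ k, (∃ j ≤ l, P i ∈ outBall ddist δ (Q j)) ∨ (∃ j ≤ m, P i ∈ inBall ddist δ (R j))

variable (V) in
/-- The digraph is hyperbolic. -/
def IsHyperbolic : Prop := ∃ δ : ℝ≥0, IsDeltaHyperbolic V δ

variable (V) in
/-- Every vertex has finite out-degree. -/
def FiniteOutDegree : Prop := ∀ x : V, {y : V | ddist x y = 1}.Finite

variable (V) in
/-- Every vertex has finite in-degree. -/
def FiniteInDegree : Prop := ∀ x : V, {y : V | ddist y x = 1}.Finite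

variable (V) in
/-- All in- and out-degrees are finite. -/
def IsLocallyFinite : Prop := FiniteOutDegree V ∧ FiniteInDegree V

/-- Distinct vertices `R 0, R 1, …` with edges from `R i` to `R (i + 1)`. -/
def IsRay (R : ℕ → V) : Prop := Function.Injective R ∧ ∀ i, Adj (R i) (R (i + 1))

/-- Distinct vertices `R 0, R 1, …` with edges from `R (i + 1)` to `R i`. -/
def IsAntiRay (R : ℕ → V) : Prop := Function.Injective R ∧ ∀ i, Adj (R (i + 1)) (R i)

variable (V) in
/-- The geodesic rays: rays all of whose finite directed subpaths are geodesics. -/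
def geodesicRays : Set (ℕ → V) :=
  {R | IsRay R ∧ ∀ i k : ℕ, ddist (R i) (R (i + k)) = k}

variable (V) in
/-- The geodesic anti-rays: anti-rays all of whose finite directed subpaths are geodesics. -/
def geodesicAntiRays : Set (ℕ → V) :=
  {R | IsAntiRay R ∧ ∀ i k : ℕ, ddist (R (i + k)) (R i) = k}

/-- `R ≤ S`: for some `M`, outside of every union of an out-ball and an in-ball of the same
radius and centre there is a directed path of length at most `M` from a vertex of `R` to a
vertex of `S`. -/
def RayLE (R S : ℕ → V) : Prop :=
  ∃ M : ℕ, ∀ (r : ℝ≥0) (x : V), ∃ (n : ℕ) (p : ℕ → V), IsDirectedPath n p ∧ n ≤ M ∧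
    p 0 ∈ Set.range R ∧ p n ∈ Set.range S ∧
    ∀ i ≤ n, p i ∉ outBall ddist r x ∪ inBall ddist r x

/-- `R ≈ S`: both `R ≤ S` and `S ≤ R`. -/
def RayEquiv (R S : ℕ → V) : Prop := RayLE R S ∧ RayLE S R

/-- The set of classes of `≈` restricted to a set `𝓡` of sequences of vertices. -/
def Boundary (𝓡 : Set (ℕ → V)) : Type _ :=
  {η : Set (ℕ → V) // ∃ R ∈ 𝓡, η = {S | S ∈ 𝓡 ∧ RayEquiv R S}}

/-- The order on classes that is induced by `≤` on representatives. -/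
instance (𝓡 : Set (ℕ → V)) : LE (Boundary 𝓡) :=
  ⟨fun η μ => ∃ R ∈ η.1, ∃ S ∈ μ.1, RayLE R S⟩

variable (V) in
/-- The geodesic f-boundary. -/
abbrev GeodesicFBoundary : Type _ := Boundary (geodesicRays V)

variable (V) in
/-- The geodesic b-boundary. -/
abbrev GeodesicBBoundary : Type _ := Boundary (geodesicAntiRays V)

variable (V) in
/-- The geodesic boundary. -/
abbrev GeodesicBoundary : Type _ := Boundary (geodesicRays V ∪ geodesicAntiRays V)

/-- `F` is the map on boundaries that is defined by `f`: it sends the class of `R` to the class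
of all `S` (of the kind considered) that are equivalent to the image of `R` under `f`. -/
def IsInducedBy {W : Type*} [Quiver W] {𝓡 : Set (ℕ → V)} {𝓢 : Set (ℕ → W)}
    (F : Boundary 𝓡 → Boundary 𝓢) (f : V → W) : Prop :=
  ∀ η : Boundary 𝓡, ∀ R ∈ η.1, (F η).1 = {S | S ∈ 𝓢 ∧ RayEquiv (f ∘ R) S}

end Digraph

end HypDigraph

namespace HypDigraph

/-! ### Distance relations

`c x y n` is read as `d(x, y) ≤ n`. -/

section DistRel

variable {V : Type*} {c : V → V → ℕ → Prop} {δ A : ℕ}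

/-! The core is a Morse lemma for asymmetric distances: a quasi-geodesic and a geodesic with the
same end vertices lie in bounded out- and in-neighbourhoods of each other (`IsHyp.exists_stable`).
Thin triangles and (B1), (B2) at the single radius δ give ball bounds that are linear in the radius
(`IsThin.isHyp`). A geodesic strays from a walk at most logarithmically in the number of steps
(`IsHyp.exists_log`). If a geodesic is tracked by a quasi-geodesic within `D`, a local detour along
the quasi-geodesic takes only linearly many steps in `D`, so any large `D` can be lowered
(`IsHyp.exists_improve`).

A quasi-isometry maps a geodesic ray to a quasi-geodesic one. Geodesics to its vertices have a limit
by finite out-degrees, and stability makes the limit ray near the image (`IsHyp.exists_isNear`). A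
quasi-inverse shows that every ray of the target is reached up to nearness.

For the order, `rayLE_iff` turns avoidance of balls into bounded distances between arbitrarily late
vertices. This relation is invariant under quasi-isometries and, against proper sequences, under
nearness; it is transitive on rays and anti-rays by `FreqLE.trans`. Hence `exists_orderIso` applies.
Working with abstract relations `c` lets `rev c` exchange in with out and rays with anti-rays, so
one half of each symmetric argument suffices. -/

/-- `p 0, …, p k` is a geodesic for the distance relation `c`. -/
def IsGeod (c : V → V → ℕ → Prop) (k : ℕ) (p : ℕ → V) : Prop :=
  ∀ i j, i ≤ j → j ≤ k → c (p i) (p j) (j - i) ∧ ∀ n, c (p i) (p j) n → j - i ≤ n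

/-- The distance relation with all directions reversed. -/
def rev (c : V → V → ℕ → Prop) : V → V → ℕ → Prop := fun x y n => c y x n

/-- A distance relation with geodesics all of whose triangles `[A, B]`, `[B, C]`, `[A, C]` are
`δ`-thin. -/
structure IsThin (c : V → V → ℕ → Prop) (δ : ℕ) : Prop where
  refl : ∀ x, c x x 0
  mono : ∀ {x y m n}, c x y m → m ≤ n → c x y n
  trans : ∀ {x y z m n}, c x y m → c y z n → c x z (m + n)
  geod : ∀ {x y n}, c x y n → ∃ k p, IsGeod c k p ∧ p 0 = x ∧ p k = y
  thin_long : ∀ {k l m P Q R}, IsGeod c k P → IsGeod c l Q → IsGeod c m R →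
    P 0 = Q 0 → Q l = R 0 → P k = R m →
    ∀ i ≤ k, (∃ j ≤ l, c (Q j) (P i) δ) ∨ ∃ j ≤ m, c (P i) (R j) δ
  thin_first : ∀ {k l m P Q R}, IsGeod c k P → IsGeod c l Q → IsGeod c m R →
    P 0 = Q 0 → Q l = R 0 → P k = R m →
    ∀ i ≤ l, (∃ j ≤ k, c (P j) (Q i) δ) ∨ ∃ j ≤ m, c (Q i) (R j) δ
  thin_second : ∀ {k l m P Q R}, IsGeod c k P → IsGeod c l Q → IsGeod c m R →
    P 0 = Q 0 → Q l = R 0 → P k = R m →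
    ∀ i ≤ m, (∃ j ≤ l, c (Q j) (R i) δ) ∨ ∃ j ≤ k, c (R i) (P j) δ

/-- A thin distance relation in which finite distances within balls are bounded linearly in the
radius. -/
structure IsHyp (c : V → V → ℕ → Prop) (δ A : ℕ) : Prop extends IsThin c δ where
  out : ∀ {x y z n} (r : ℕ), c x y r → c x z r → c y z n → c y z (A * (r + 1))
  inn : ∀ {x y z n} (r : ℕ), c y x r → c z x r → c y z n → c y z (A * (r + 1))

/-- A discrete continuity principle: sweeping along one path, it locates the edge at which closeness
to a part of another path is lost. -/
lemma exists_step {p : ℕ → Prop} (h0 : p 0) (k : ℕ) : p k ∨ ∃ i < k, p i ∧ ¬ p (i + 1) := by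
  induction k with
  | zero => exact Or.inl h0
  | succ k ih =>
    rcases ih with h | ⟨i, hi, h⟩
    · by_cases h' : p (k + 1)
      · exact Or.inl h'
      · exact Or.inr ⟨k, k.lt_succ_self, h, h'⟩
    · exact Or.inr ⟨i, by omega, h⟩

namespace IsGeod

variable {k : ℕ} {p : ℕ → V}

lemma close (h : IsGeod c k p) {i j : ℕ} (hij : i ≤ j) (hj : j ≤ k) : c (p i) (p j) (j - i) :=
  (h i j hij hj).1

lemma le (h : IsGeod c k p) {i j n : ℕ} (hij : i ≤ j) (hj : j ≤ k) (hc : c (p i) (p j) n) :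
    j - i ≤ n :=
  (h i j hij hj).2 n hc

lemma prefix_le (h : IsGeod c k p) {l : ℕ} (hl : l ≤ k) : IsGeod c l p :=
  fun i j hij hj => h i j hij (hj.trans hl)

lemma shift (h : IsGeod c k p) (a : ℕ) {l : ℕ} (hl : a + l ≤ k) :
    IsGeod c l (fun i => p (a + i)) := fun i j hij hj => by
  have := h (a + i) (a + j) (by omega) (by omega)
  rwa [show a + j - (a + i) = j - i by omega] at this

lemma reverse (h : IsGeod c k p) : IsGeod (rev c) k (fun i => p (k - i)) := fun i j hij hj => by
  have := h (k - j) (k - i) (by omega) (by omega)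
  rwa [show k - i - (k - j) = j - i by omega] at this

end IsGeod

/-- Reversal keeps the long side of a transitive triangle and swaps the other two, so `thin_first`
and `thin_second` exchange roles. -/
lemma IsThin.reverse (h : IsThin c δ) : IsThin (rev c) δ where
  refl := h.refl
  mono := fun hc hn => h.mono (c := c) hc hn
  trans := fun h1 h2 => by
    have := h.trans h2 h1
    rwa [add_comm] at this
  geod := fun hc => by
    obtain ⟨k, p, hp, h0, hk⟩ := h.geod hc
    exact ⟨k, _, hp.reverse, by simpa using hk, by simpa using h0⟩
  thin_long := by
    intro k l m P Q R hP hQ hR h1 h2 h3 i hi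
    rcases h.thin_long hP.reverse hR.reverse hQ.reverse (by simpa using h3) (by simpa using h2.symm)
      (by simpa using h1) (k - i) (by omega) with ⟨j, hj, hc⟩ | ⟨j, hj, hc⟩
    · refine Or.inr ⟨m - j, by omega, ?_⟩
      rwa [show k - (k - i) = i by omega] at hc
    · refine Or.inl ⟨l - j, by omega, ?_⟩
      rwa [show k - (k - i) = i by omega] at hc
  thin_first := by
    intro k l m P Q R hP hQ hR h1 h2 h3 i hi
    rcases h.thin_second hP.reverse hR.reverse hQ.reverse (by simpa using h3)
      (by simpa using h2.symm) (by simpa using h1) (l - i) (by omega) with ⟨j, hj, hc⟩ | ⟨j, hj, hc⟩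
    · refine Or.inr ⟨m - j, by omega, ?_⟩
      rwa [show l - (l - i) = i by omega] at hc
    · refine Or.inl ⟨k - j, by omega, ?_⟩
      rwa [show l - (l - i) = i by omega] at hc
  thin_second := by
    intro k l m P Q R hP hQ hR h1 h2 h3 i hi
    rcases h.thin_first hP.reverse hR.reverse hQ.reverse (by simpa using h3)
      (by simpa using h2.symm) (by simpa using h1) (m - i) (by omega) with ⟨j, hj, hc⟩ | ⟨j, hj, hc⟩
    · refine Or.inr ⟨k - j, by omega, ?_⟩
      rwa [show m - (m - i) = i by omega] at hc
    · refine Or.inl ⟨l - j, by omega, ?_⟩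
      rwa [show m - (m - i) = i by omega] at hc

lemma IsHyp.reverse (h : IsHyp c δ A) : IsHyp (rev c) δ A where
  toIsThin := h.toIsThin.reverse
  out := fun r h1 h2 h3 => h.inn r h2 h1 h3
  inn := fun r h1 h2 h3 => h.out r h2 h1 h3

/-- In a geodesic each of whose vertices is within `δ` of one of few vertices, counting bounds
the length. -/
lemma IsGeod.length_le_of_cover {g l k m : ℕ} {P Q R : ℕ → V} (hP : IsGeod c k P)
    (hout : ∀ x y z n, c x y δ → c x z δ → c y z n → c y z g)
    (hinn : ∀ x y z n, c y x δ → c z x δ → c y z n → c y z g)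
    (hcov : ∀ i ≤ k, (∃ j ≤ l, c (Q j) (P i) δ) ∨ ∃ j ≤ m, c (P i) (R j) δ) :
    k ≤ (g + 1) * (l + 1 + (m + 1)) := by
  classical
  have hx : ∀ i : ℕ, ∃ s : Fin (l + 1) ⊕ Fin (m + 1), i ≤ k →
      Sum.elim (fun j : Fin (l + 1) => c (Q j) (P i) δ) (fun j : Fin (m + 1) => c (P i) (R j) δ) s := by
    intro i
    by_cases hi : i ≤ k
    · rcases hcov i hi with ⟨j, hj, hc⟩ | ⟨j, hj, hc⟩
      · exact ⟨Sum.inl ⟨j, by omega⟩, fun _ => hc⟩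
      · exact ⟨Sum.inr ⟨j, by omega⟩, fun _ => hc⟩
    · exact ⟨Sum.inl 0, fun h => absurd h hi⟩
  choose φ hφ using hx
  -- Vertices of `P` assigned to the same centre are joined along `P`, so the ball bounds apply;
  -- each fibre of `φ` has at most `g + 1` indices.
  have hdist : ∀ i j, i ≤ j → j ≤ k → φ i = φ j → j - i ≤ g := by
    intro i j hij hj he
    have h1 := hφ i (hij.trans hj)
    have h2 := hφ j hj
    rw [he] at h1
    refine hP.le hij hj ?_
    rcases hs : φ j with s | s
    · rw [hs] at h1 h2
      exact hout _ _ _ _ h1 h2 (hP.close hij hj)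
    · rw [hs] at h1 h2
      exact hinn _ _ _ _ h1 h2 (hP.close hij hj)
  have hcard := Finset.card_le_mul_card_image_of_maps_to (s := Finset.range (k + 1))
    (t := (Finset.univ : Finset (Fin (l + 1) ⊕ Fin (m + 1)))) (f := φ)
    (fun _ _ => Finset.mem_univ _) (g + 1) (by
      intro s _
      rcases (Finset.filter (fun i => φ i = s) (Finset.range (k + 1))).eq_empty_or_nonempty
        with he | hne
      · rw [he]; simp
      · set T := Finset.filter (fun i => φ i = s) (Finset.range (k + 1)) with hT
        have hmem : ∀ j ∈ T, j ≤ k ∧ φ j = s := fun j hj => by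
          rw [hT, Finset.mem_filter, Finset.mem_range] at hj
          exact ⟨by omega, hj.2⟩
        have hsub : T ⊆ Finset.Icc (T.min' hne) (T.min' hne + g) := by
          intro j hj
          have h0 := T.min'_mem hne
          have hle := T.min'_le j hj
          have := hdist _ j hle (hmem j hj).1 ((hmem _ h0).2.trans (hmem j hj).2.symm)
          rw [Finset.mem_Icc]
          omega
        refine (Finset.card_le_card hsub).trans ?_
        rw [Nat.card_Icc]; omega)
  simp only [Finset.card_range, Finset.card_univ, Fintype.card_sum, Fintype.card_fin] at hcard
  omega

/-- If two sides of a triangle have length at most `r`, the third is covered by δ-balls around at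
most `2 * (r + 1)` vertices. Counting thus upgrades bounds at radius δ to linear bounds at every
radius. -/
lemma IsThin.isHyp (h : IsThin c δ) {g : ℕ}
    (hout : ∀ x y z n, c x y δ → c x z δ → c y z n → c y z g)
    (hinn : ∀ x y z n, c y x δ → c z x δ → c y z n → c y z g) :
    IsHyp c δ (2 * (g + 1)) where
  toIsThin := h
  out := by
    intro x y z n r h1 h2 h3
    obtain ⟨k, P, hP, hP0, hPk⟩ := h.geod h3
    obtain ⟨l, Q, hQ, hQ0, hQl⟩ := h.geod h1
    obtain ⟨m, R, hR, hR0, hRm⟩ := h.geod h2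
    have hl := hQ.le (Nat.zero_le l) le_rfl (by rw [hQ0, hQl]; exact h1)
    have hm := hR.le (Nat.zero_le m) le_rfl (by rw [hR0, hRm]; exact h2)
    have := hP.length_le_of_cover hout hinn
      (h.thin_second hR hQ hP (hR0.trans hQ0.symm) (hQl.trans hP0.symm) (hRm.trans hPk.symm))
    have h4 := hP.close (Nat.zero_le k) le_rfl
    rw [hP0, hPk] at h4
    refine h.mono h4 ?_
    have h5 : (g + 1) * (l + 1 + (m + 1)) ≤ (g + 1) * (2 * (r + 1)) :=
      Nat.mul_le_mul_left _ (by omega)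
    have h6 : (g + 1) * (2 * (r + 1)) = 2 * (g + 1) * (r + 1) := by ring
    omega
  inn := by
    intro x y z n r h1 h2 h3
    obtain ⟨k, P, hP, hP0, hPk⟩ := h.geod h3
    obtain ⟨l, Q, hQ, hQ0, hQl⟩ := h.geod h1
    obtain ⟨m, R, hR, hR0, hRm⟩ := h.geod h2
    have hl := hQ.le (Nat.zero_le l) le_rfl (by rw [hQ0, hQl]; exact h1)
    have hm := hR.le (Nat.zero_le m) le_rfl (by rw [hR0, hRm]; exact h2)
    have := hP.length_le_of_cover hout hinn
      (h.thin_first hQ hP hR (hQ0.trans hP0.symm) (hPk.trans hR0.symm) (hQl.trans hRm.symm))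
    have h4 := hP.close (Nat.zero_le k) le_rfl
    rw [hP0, hPk] at h4
    refine h.mono h4 ?_
    have h5 : (g + 1) * (l + 1 + (m + 1)) ≤ (g + 1) * (2 * (r + 1)) :=
      Nat.mul_le_mul_left _ (by omega)
    have h6 : (g + 1) * (2 * (r + 1)) = 2 * (g + 1) * (r + 1) := by ring
    omega

end DistRel

/-! ### Fellow travelling and logarithmic closeness to walks -/

section Morse

variable {V : Type*} {c : V → V → ℕ → Prop} {δ A : ℕ}

/-- Two geodesics that start at the same vertex and whose last vertices are close to each other
run close to each other. -/
lemma IsHyp.exists_fellow (h : IsHyp c δ A) (r : ℕ) : ∃ K, ∀ {k l : ℕ} {P Q : ℕ → V},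
    IsGeod c k P → IsGeod c l Q → P 0 = Q 0 → c (Q l) (P k) r →
    (∀ i ≤ k, ∃ j ≤ l, c (Q j) (P i) K) ∧
    (∀ i ≤ k, (∃ j ≤ l, c (P i) (Q j) K) ∨ c (P i) (P k) K) ∧
    ∀ j ≤ l, ∃ i ≤ k, c (Q j) (P i) K := by
  obtain ⟨K, hK⟩ : ∃ K, K = A * (2 * δ + r + 2) + 2 * δ + r + 1 := ⟨_, rfl⟩
  refine ⟨K, ?_⟩
  intro k l P Q hP hQ h0 huv
  have hA : A * (δ + 1 + 1) ≤ A * (2 * δ + r + 2) := Nat.mul_le_mul_left _ (by omega)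
  obtain ⟨m, S, hS, hS0, hSm⟩ := h.geod huv
  have hm : m ≤ r := hS.le (Nat.zero_le m) le_rfl (by rw [hS0, hSm]; exact huv)
  have hshort : ∀ j ≤ m, c (S j) (P k) r := fun j hj => by
    rw [← hSm]
    exact h.mono (hS.close hj le_rfl) (by omega)
  have t1 : ∀ i ≤ k, (∃ j ≤ l, c (Q j) (P i) δ) ∨ c (P i) (P k) (δ + r) := fun i hi =>
    (h.thin_long hP hQ hS h0 hS0.symm hSm.symm i hi).imp_right
      fun ⟨j, hj, hc⟩ => h.trans hc (hshort j hj)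
  have t2 : ∀ j ≤ l, (∃ i ≤ k, c (P i) (Q j) δ) ∨ c (Q j) (P k) (δ + r) := fun i hi =>
    (h.thin_first hP hQ hS h0 hS0.symm hSm.symm i hi).imp_right
      fun ⟨j, hj, hc⟩ => h.trans hc (hshort j hj)
  refine ⟨fun i hi => ?_, fun i hi => ?_, fun j hj => ?_⟩
  · by_cases hi' : i ≤ δ + r
    · refine ⟨0, Nat.zero_le _, ?_⟩
      rw [← h0]
      exact h.mono (hP.close (Nat.zero_le i) hi) (by omega)
    -- Stepping back by `δ + r + 1` puts the vertex too far from `P k` for the second alternative of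
    -- `t1`.
    · rcases t1 (i - (δ + r + 1)) (by omega) with ⟨j, hj, hc⟩ | hc
      · exact ⟨j, hj, h.mono (h.trans hc (hP.close (Nat.sub_le _ _) hi)) (by omega)⟩
      · have := hP.le (by omega) le_rfl hc
        omega
  -- Sweep along `Q` until it is no longer reached from `P 0, …, P i`. At the switch, vertices of
  -- `P` on both sides of `P i` lie in one in-ball around `Q (j + 1)`, and (B2) bounds the piece of
  -- `P` between them.
  · rcases exists_step (p := fun j => j ≤ l → ∃ i' ≤ i, c (P i') (Q j) δ)
      (fun _ => ⟨0, Nat.zero_le _, h.mono (h0 ▸ h.refl _) (Nat.zero_le _)⟩) l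
      with hp | ⟨j, hj, hp, hp'⟩
    · obtain ⟨i', hi', hc⟩ := hp le_rfl
      have := hP.le (hi'.trans hi) le_rfl (h.trans hc huv)
      exact Or.inr (h.mono (hP.close hi le_rfl) (by omega))
    · obtain ⟨i', hi', hc⟩ := hp hj.le
      have hc1 := h.trans hc (hQ.close j.le_succ hj)
      rw [show j.succ - j = 1 by omega] at hc1
      rcases t2 (j + 1) hj with ⟨i'', hi'', hc'⟩ | hc'
      · have hlt : i < i'' := by
          by_contra hcon
          exact hp' fun _ => ⟨i'', by omega, hc'⟩
        have hd := hP.le (by omega) hi''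
          (h.inn (δ + 1) hc1 (h.mono hc' (by omega)) (hP.close (by omega) hi''))
        exact Or.inl ⟨j + 1, hj, h.mono (h.trans (hP.close hlt.le hi'') hc') (by omega)⟩
      · have := hP.le (hi'.trans hi) le_rfl (h.trans hc1 hc')
        exact Or.inr (h.mono (hP.close hi le_rfl) (by omega))
  · have hend : ∀ j' ≤ j, c (Q j') (P k) (2 * δ + r + 1) → ∃ i ≤ k, c (Q j) (P i) K := by
      intro j' hj' hc
      have := hQ.le (hj'.trans hj) le_rfl (h.inn (2 * δ + r + 1) hc (h.mono huv (by omega))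
        (hQ.close (hj'.trans hj) le_rfl))
      exact ⟨k, le_rfl, h.mono (h.trans (hQ.close hj le_rfl) huv) (by
        rw [show 2 * δ + r + 1 + 1 = 2 * δ + r + 2 by ring] at this; omega)⟩
    rcases exists_step (p := fun i => i ≤ k → ∃ j' ≤ j, c (Q j') (P i) δ)
      (fun _ => ⟨0, Nat.zero_le _, h.mono (h0 ▸ h.refl _) (Nat.zero_le _)⟩) k
      with hp | ⟨i, hi, hp, hp'⟩
    · obtain ⟨j', hj', hc⟩ := hp le_rfl
      exact hend j' hj' (h.mono hc (by omega))
    · obtain ⟨j', hj', hc⟩ := hp hi.le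
      have hc1 := h.trans hc (hP.close i.le_succ hi)
      rw [show i.succ - i = 1 by omega] at hc1
      rcases t1 (i + 1) hi with ⟨j'', hj'', hc'⟩ | hc'
      · have hlt : j < j'' := by
          by_contra hcon
          exact hp' fun _ => ⟨j'', by omega, hc'⟩
        have hd := hQ.le (by omega) hj''
          (h.inn (δ + 1) hc1 (h.mono hc' (by omega)) (hQ.close (by omega) hj''))
        exact ⟨i + 1, hi, h.mono (h.trans (hQ.close hlt.le hj'') hc') (by omega)⟩
      · exact hend j' hj' (h.mono (h.trans hc1 hc') (by omega))

/-- The long side of a triangle lies in an out-neighbourhood of the two other sides. -/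
lemma IsHyp.exists_triangle (h : IsHyp c δ A) : ∃ K, ∀ {k l m : ℕ} {P Q R : ℕ → V},
    IsGeod c k P → IsGeod c l Q → IsGeod c m R → P 0 = Q 0 → Q l = R 0 → P k = R m →
    ∀ i ≤ k, (∃ j ≤ l, c (Q j) (P i) K) ∨ ∃ j ≤ m, c (R j) (P i) K := by
  obtain ⟨K₁, hK₁⟩ := h.exists_fellow δ
  obtain ⟨K₂, hK₂⟩ := h.reverse.exists_fellow (δ + 1)
  refine ⟨K₁ + (K₂ + δ), ?_⟩
  intro k l m P Q R hP hQ hR h1 h2 h3 i hi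
  -- The vertex of `P` at which closeness to `Q` changes into closeness to `R`; the extra 1 is the
  -- edge across the switch.
  obtain ⟨i₀, hi₀, j₀, hj₀, m₀, hm₀, hu, hv⟩ : ∃ i₀ ≤ k, ∃ j₀ ≤ l, ∃ m₀ ≤ m,
      c (Q j₀) (P i₀) δ ∧ c (P i₀) (R m₀) (δ + 1) := by
    rcases exists_step (p := fun i => i ≤ k → ∃ j ≤ l, c (Q j) (P i) δ)
      (fun _ => ⟨0, Nat.zero_le _, h.mono (h1 ▸ h.refl _) (Nat.zero_le _)⟩) k
      with hp | ⟨i, hi, hp, hp'⟩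
    · obtain ⟨j, hj, hc⟩ := hp le_rfl
      exact ⟨k, le_rfl, j, hj, m, le_rfl, hc, h.mono (h3 ▸ h.refl _) (Nat.zero_le _)⟩
    · obtain ⟨j, hj, hc⟩ := hp hi.le
      rcases h.thin_long hP hQ hR h1 h2 h3 (i + 1) hi with hc' | ⟨m₀, hm₀, hc'⟩
      · exact absurd (fun _ => hc') hp'
      · have hc1 := h.trans (hP.close i.le_succ hi) hc'
        rw [show i.succ - i = 1 by omega] at hc1
        exact ⟨i, hi.le, j, hj, m₀, hm₀, hc, h.mono hc1 (by omega)⟩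
  -- Before the switch `P` follows `Q`. After it, the reversed fellow-travelling statement turns
  -- closeness towards `R` into closeness from `R`.
  rcases le_total i i₀ with hle | hle
  · obtain ⟨j, hj, hc⟩ := (hK₁ (hP.prefix_le hi₀) (hQ.prefix_le hj₀) h1 hu).1 i hle
    exact Or.inl ⟨j, hj.trans hj₀, h.mono hc (by omega)⟩
  · rcases (hK₂ (hP.reverse.prefix_le (Nat.sub_le k i₀)) (hR.reverse.prefix_le (Nat.sub_le m m₀))
      (by simpa using h3) (by
        rw [show k - (k - i₀) = i₀ by omega, show m - (m - m₀) = m₀ by omega]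
        exact hv)).2.1 (k - i) (by omega) with ⟨j, hj, hc⟩ | hc
    · refine Or.inr ⟨m - j, by omega, ?_⟩
      rw [show k - (k - i) = i by omega] at hc
      exact h.mono (c := c) hc (by omega)
    · rw [show k - (k - i) = i by omega, show k - (k - i₀) = i₀ by omega] at hc
      exact Or.inl ⟨j₀, hj₀, h.mono (h.trans (c := c) hu hc) (by omega)⟩

/-- `q 0, …, q n` is a quasi-geodesic. -/
structure IsQuasiGeod (c : V → V → ℕ → Prop) (L n : ℕ) (q : ℕ → V) : Prop where
  step : ∀ i < n, c (q i) (q (i + 1)) L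
  le : ∀ {i j m}, i ≤ j → j ≤ n → c (q i) (q j) m → j - i ≤ L * (m + 1)

lemma IsThin.walk (h : IsThin c δ) {q : ℕ → V} {L i j : ℕ} (hij : i ≤ j)
    (hq : ∀ t, i ≤ t → t < j → c (q t) (q (t + 1)) L) : c (q i) (q j) (L * (j - i)) := by
  induction j, hij using Nat.le_induction with
  | base => exact h.mono (h.refl _) (Nat.zero_le _)
  | succ j hij ih =>
    have := h.trans (ih fun t h1 h2 => hq t h1 (by omega)) (hq j hij j.lt_succ_self)
    rwa [show L * (j - i) + L = L * (j + 1 - i) by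
      rw [show j + 1 - i = j - i + 1 by omega]; ring] at this

lemma IsQuasiGeod.close (h : IsThin c δ) {q : ℕ → V} {L n : ℕ} (hq : IsQuasiGeod c L n q)
    {i j : ℕ} (hij : i ≤ j) (hj : j ≤ n) : c (q i) (q j) (L * (j - i)) :=
  h.walk hij fun t _ ht => hq.step t (by omega)

lemma IsQuasiGeod.reverse {q : ℕ → V} {L n : ℕ} (hq : IsQuasiGeod c L n q) :
    IsQuasiGeod (rev c) L n (fun i => q (n - i)) where
  step := fun i hi => by
    have := hq.step (n - (i + 1)) (by omega)
    rwa [show n - (i + 1) + 1 = n - i by omega] at this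
  le := fun {i j m} hij hj hc => by
    have := hq.le (i := n - j) (j := n - i) (by omega) (by omega) hc
    omega

/-- A geodesic stays within logarithmic distance of a walk with the same end vertices. -/
lemma IsHyp.exists_log (h : IsHyp c δ A) : ∃ K, ∀ (L : ℕ) (q : ℕ → V) (e a b : ℕ), a ≤ b →
    b ≤ a + 2 ^ e → (∀ t, a ≤ t → t < b → c (q t) (q (t + 1)) L) →
    ∀ (k : ℕ) (P : ℕ → V), IsGeod c k P → P 0 = q a → P k = q b →
    ∀ i ≤ k, ∃ j, a ≤ j ∧ j ≤ b ∧ c (q j) (P i) (K * e + L) := by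
  obtain ⟨K, hK⟩ := h.exists_triangle
  refine ⟨K, fun L q e => ?_⟩
  induction e with
  | zero =>
    intro a b hab hb hq k P hP h0 hk i hi
    refine ⟨a, le_rfl, hab, ?_⟩
    have hw := h.walk hab hq
    rw [← h0, ← hk] at hw
    have hl := hP.le (Nat.zero_le k) le_rfl hw
    have h2 : L * (b - a) ≤ L * 1 := Nat.mul_le_mul_left _ (by omega)
    rw [← h0]
    exact h.mono (hP.close (Nat.zero_le i) hi) (by omega)
  | succ e ih =>
    intro a b hab hb hq k P hP h0 hk i hi
    rw [pow_succ] at hb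
    -- Halving the walk costs one triangle constant per level, hence `K * e` in total.
    obtain ⟨m, ham, hmb, hm1, hm2⟩ : ∃ m, a ≤ m ∧ m ≤ b ∧ m ≤ a + 2 ^ e ∧ b ≤ m + 2 ^ e :=
      ⟨a + (b - a) / 2, by omega, by omega, by omega, by omega⟩
    have hq1 : ∀ t, a ≤ t → t < m → c (q t) (q (t + 1)) L := fun t h1 h2 => hq t h1 (by omega)
    have hq2 : ∀ t, m ≤ t → t < b → c (q t) (q (t + 1)) L := fun t h1 h2 => hq t (by omega) h2
    obtain ⟨l, Q, hQ, hQ0, hQl⟩ := h.geod (h.walk ham hq1)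
    obtain ⟨s, R, hR, hR0, hRs⟩ := h.geod (h.walk hmb hq2)
    rcases hK hP hQ hR (h0.trans hQ0.symm) (hQl.trans hR0.symm) (hk.trans hRs.symm) i hi
      with ⟨j, hj, hc⟩ | ⟨j, hj, hc⟩
    · obtain ⟨t, ht1, ht2, ht⟩ := ih a m ham hm1 hq1 l Q hQ hQ0 hQl j hj
      exact ⟨t, ht1, ht2.trans hmb, h.mono (h.trans ht hc) (by rw [mul_add]; omega)⟩
    · obtain ⟨t, ht1, ht2, ht⟩ := ih m b hmb hm2 hq2 s R hR hR0 hRs j hj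
      exact ⟨t, ham.trans ht1, ht2, h.mono (h.trans ht hc) (by rw [mul_add]; omega)⟩

lemma exists_linear_le_two_pow (a b : ℕ) : ∃ e₀, ∀ e ≥ e₀, a * e + b ≤ 2 ^ e := by
  refine ⟨2 * (a + b) + 1, fun e he => ?_⟩
  induction e, he using Nat.le_induction with
  | base =>
    have h1 : a + b + 1 ≤ 2 ^ (a + b) := Nat.lt_two_pow_self
    have h2 : 2 ^ (2 * (a + b) + 1) = 2 * (2 ^ (a + b) * 2 ^ (a + b)) := by ring
    rw [h2]
    have h3 := Nat.mul_le_mul h1 h1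
    nlinarith
  | succ e he ih =>
    have h1 : e < 2 ^ e := Nat.lt_two_pow_self
    rw [pow_succ]
    nlinarith

/-- Exponential growth beats linear growth: `e` grows like `D / (K + 1)`, slowly enough for the
second bound and fast enough for the first. -/
lemma exists_exponent (a b K B : ℕ) : ∃ D₀, ∀ D ≥ D₀, ∃ e, a * D + b ≤ 2 ^ e ∧ K * e + B < D := by
  obtain ⟨e₀, he₀⟩ := exists_linear_le_two_pow (a * (K + 1)) (a * (K + 1 + B + 1) + b)
  refine ⟨(K + 1) * e₀ + B + 1, fun D hD => ⟨(D - B - 1) / (K + 1), ?_, ?_⟩⟩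
  · refine le_trans ?_ (he₀ _ ?_)
    · have h1 := Nat.lt_mul_div_succ (D - B - 1) (show 0 < K + 1 by omega)
      generalize (D - B - 1) / (K + 1) = e at *
      have h2 : D ≤ (K + 1) * e + (K + 1 + B + 1) := by rw [mul_add] at h1; omega
      calc a * D + b ≤ a * ((K + 1) * e + (K + 1 + B + 1)) + b := by gcongr
        _ = _ := by ring
    · rw [ge_iff_le, Nat.le_div_iff_mul_le (by omega), mul_comm]
      omega
  · have h1 := Nat.mul_div_le (D - B - 1) (K + 1)
    rw [add_mul] at h1
    omega

end Morse

/-! ### Stability of quasi-geodesics -/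

section Stability

variable {V : Type*} {c : V → V → ℕ → Prop} {δ A : ℕ}

/-- `P 0, …, P k` and `q 0, …, q n` share their end vertices, and each `P w` lies in the out-ball
and in the in-ball of radius `D` around vertices `q i`. -/
structure IsTracked (c : V → V → ℕ → Prop) (D k n : ℕ) (P q : ℕ → V) : Prop where
  first : P 0 = q 0
  last : P k = q n
  out : ∀ w ≤ k, ∃ i ≤ n, c (q i) (P w) D
  inn : ∀ w ≤ k, ∃ i ≤ n, c (P w) (q i) D

lemma IsTracked.reverse {D k n : ℕ} {P q : ℕ → V} (h : IsTracked c D k n P q) :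
    IsTracked (rev c) D k n (fun i => P (k - i)) (fun i => q (n - i)) where
  first := by simpa using h.last
  last := by simpa using h.first
  out := fun w _ => by
    obtain ⟨i, hi, hc⟩ := h.inn (k - w) (Nat.sub_le _ _)
    exact ⟨n - i, Nat.sub_le _ _, by rwa [show n - (n - i) = i by omega]⟩
  inn := fun w _ => by
    obtain ⟨i, hi, hc⟩ := h.out (k - w) (Nat.sub_le _ _)
    exact ⟨n - i, Nat.sub_le _ _, by rwa [show n - (n - i) = i by omega]⟩

lemma IsQuasiGeod.le_of_out (h : IsHyp c δ A) {q : ℕ → V} {L n : ℕ} (hq : IsQuasiGeod c L n q)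
    {x : V} {i j : ℕ} (r : ℕ) (hij : i ≤ j) (hj : j ≤ n) (h1 : c x (q i) r) (h2 : c x (q j) r) :
    j - i ≤ L * (A * (r + 1) + 1) :=
  hq.le hij hj (h.out r h1 h2 (hq.close h.toIsThin hij hj))

/-- The points that a geodesic passes close to a quasi-geodesic appear in the same order on
both, up to a bounded error. -/
lemma IsTracked.sub_le (h : IsHyp c δ A) {L D k n : ℕ} {P q : ℕ → V}
    (hq : IsQuasiGeod c L n q) (hP : IsGeod c k P) (ht : IsTracked c D k n P q)
    {w w' i i' X : ℕ} (hw : w ≤ w') (hw' : w' ≤ k) (hi : i ≤ n) (hi' : i' ≤ n)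
    (hc : c (P w) (q i) D) (hc' : c (P w') (q i') D) (hX : i' ≤ i + X) :
    w' - w ≤ A * (L * (L * (A * (D + 2) + 1) + X) + D + 1) := by
  obtain ⟨E, hE⟩ : ∃ E, E = L * (A * (D + 2) + 1) + X := ⟨_, rfl⟩
  rw [← hE]
  have hEL : ∀ j ≤ E, L * j ≤ L * E := fun j hj => Nat.mul_le_mul_left _ hj
  -- Then `P v` and `P w'` lie in one in-ball around `q i'`, and (B2) bounds `w' - v`, which is at
  -- least `w' - w`.
  suffices hs : ∃ v ≤ w, c (P v) (q i') (L * E + D) by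
    obtain ⟨v, hv, hcv⟩ := hs
    have := hP.le (hv.trans hw) hw'
      (h.inn (L * E + D) hcv (h.mono hc' (by omega)) (hP.close (hv.trans hw) hw'))
    omega
  rcases le_total i i' with hii | hii
  · have := hEL (i' - i) (by omega)
    exact ⟨w, le_rfl, h.mono (h.trans hc (hq.close h.toIsThin hii hi')) (by omega)⟩
  -- Tracking indices of consecutive vertices of `P` increase by a bounded amount, so the sweep
  -- cannot jump far over `i'`.
  · have hjump : ∀ v < k, ∀ j ≤ n, ∀ j' ≤ n, j ≤ j' → c (P v) (q j) D → c (P (v + 1)) (q j') D →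
        j' - j ≤ E := by
      intro v hv j hj j' hj' hjj h1 h2
      have h3 := h.trans (hP.close v.le_succ hv) h2
      rw [show v.succ - v = 1 by omega] at h3
      have := hq.le_of_out h (D + 1) hjj hj' (h.mono h1 (by omega)) (h.mono h3 (by omega))
      rw [show D + 1 + 1 = D + 2 by ring] at this
      omega
    rcases exists_step (p := fun v => ∃ j ≤ i', c (P v) (q j) D)
      ⟨0, Nat.zero_le _, h.mono (ht.first ▸ h.refl _) (Nat.zero_le _)⟩ w
      with ⟨j, hj, hcj⟩ | ⟨v, hv, ⟨j, hj, hcj⟩, hn⟩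
    · have hd := hq.le_of_out h (D + 1) (hj.trans hii) hi (h.mono hcj (by omega))
        (h.mono hc (by omega))
      rw [show D + 1 + 1 = D + 2 by ring] at hd
      have := hEL (i' - j) (by omega)
      exact ⟨w, le_rfl, h.mono (h.trans hcj (hq.close h.toIsThin hj hi')) (by omega)⟩
    · obtain ⟨j', hj', hcj'⟩ := ht.inn (v + 1) (by omega)
      have hlt : i' < j' := by
        by_contra hcon
        exact hn ⟨j', by omega, hcj'⟩
      have := hjump v (by omega) j (hj.trans hi') j' hj' (by omega) hcj hcj'
      have := hEL (i' - j) (by omega)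
      exact ⟨v, hv.le, h.mono (h.trans hcj (hq.close h.toIsThin hj hi')) (by omega)⟩

/-- If `P` is tracked by `q` within a large distance `D`, then the out-balls around `q` that
cover `P` can be chosen smaller. -/
lemma IsHyp.exists_improve (h : IsHyp c δ A) (L : ℕ) : ∃ D₀, ∀ D ≥ D₀, ∀ {k n : ℕ} {P q : ℕ → V},
    IsQuasiGeod c L n q → IsGeod c k P → IsTracked c D k n P q →
    ∀ v ≤ k, ∃ i ≤ n, c (q i) (P v) (D - 1) := by
  obtain ⟨K, hK⟩ := h.exists_triangle
  obtain ⟨K', hK'⟩ := h.exists_log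
  -- Three quantities that stay linear in `D`: the index error entering `IsTracked.sub_le`, the
  -- half-length `N` of a window of `P` around `P v`, and a bound on the steps of `q` across that
  -- window.
  obtain ⟨a₁, b₁, h₁⟩ : ∃ a b, ∀ D, L * (A * (D + 2) + 1) + L * (2 * D + 1) = a * D + b :=
    ⟨L * A + L * 2, L * (A * 2 + 1) + L, fun D => by ring⟩
  obtain ⟨a₂, b₂, h₂⟩ : ∃ a b, ∀ D, A * (2 * K + D + 1) + A * (L * (a₁ * D + b₁) + D + 1) + D + K + 1
      = a * D + b :=
    ⟨A + A * (L * a₁ + 1) + 1, A * (2 * K + 1) + A * (L * b₁ + 1) + K + 1, fun D => by ring⟩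
  obtain ⟨a₃, b₃, h₃⟩ : ∃ a b, ∀ D,
      L * (A * (A * (2 * (a₂ * D + b₂) + 1) + D + 1) + 1) = a * D + b :=
    ⟨L * (A * (A * 2 * a₂ + 1)), L * (A * (A * (2 * b₂ + 1) + 1) + 1), fun D => by ring⟩
  obtain ⟨D₀, hD₀⟩ := exists_exponent a₃ b₃ K' (2 * K + L)
  refine ⟨D₀, fun D hD {k n P q} hq hP ht v hv => ?_⟩
  obtain ⟨e, he, heD⟩ := hD₀ D hD
  obtain ⟨N, hN⟩ : ∃ N, N = a₂ * D + b₂ := ⟨_, rfl⟩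
  rw [← h₂] at hN
  rw [← h₃, ← h₂, ← hN] at he
  -- The window reaches `N` to each side of `v` unless cut off by an end of `P`. An edge into `q` is
  -- chosen at `a` and one out of `q` at `b`, up to distance `D`, so that the detour along `q` is
  -- directed. At a cut-off end the tracking vertex is the end itself.
  obtain ⟨a, ha, ia, hia, hca, hva, hta⟩ : ∃ a ≤ v, ∃ i ≤ n, c (P a) (q i) D ∧ v - a ≤ N ∧
      (P a = q 0 ∧ i = 0 ∨ v - a = N) := by
    by_cases hvN : N ≤ v
    · obtain ⟨i, hi, hc⟩ := ht.inn (v - N) (by omega)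
      exact ⟨v - N, by omega, i, hi, hc, by omega, Or.inr (by omega)⟩
    · exact ⟨0, Nat.zero_le _, 0, Nat.zero_le _, h.mono (ht.first ▸ h.refl _) (Nat.zero_le _),
        by omega, Or.inl ⟨ht.first, rfl⟩⟩
  obtain ⟨b, hvb, hbk, ib, hib, hcb, hbv, htb⟩ : ∃ b, v ≤ b ∧ b ≤ k ∧ ∃ i ≤ n, c (q i) (P b) D ∧
      b - v ≤ N ∧ (P b = q n ∧ i = n ∨ b - v = N) := by
    by_cases hvN : v + N ≤ k
    · obtain ⟨i, hi, hc⟩ := ht.out (v + N) hvN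
      exact ⟨v + N, by omega, hvN, i, hi, hc, by omega, Or.inr (by omega)⟩
    · exact ⟨k, hv, le_rfl, n, le_rfl, h.mono (ht.last ▸ h.refl _) (Nat.zero_le _),
        by omega, Or.inl ⟨ht.last, rfl⟩⟩
  -- Otherwise the tracking index has not advanced essentially over a full window, against the
  -- choice of `N` and `IsTracked.sub_le`.
  have hiab : ia ≤ ib := by
    rcases hta with ⟨-, rfl⟩ | hta
    · exact Nat.zero_le _
    rcases htb with ⟨-, rfl⟩ | htb
    · exact hia
    by_contra hcon
    obtain ⟨i, hi, hc⟩ := ht.inn b hbk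
    have hX : i ≤ ia + L * (2 * D + 1) := by
      rcases le_total ib i with hle | hle
      · have := hq.le hle hi (h.trans hcb hc)
        rw [← two_mul] at this
        omega
      · omega
    have := ht.sub_le h hq hP (ha.trans hvb) hbk hia hi hca hc hX
    rw [h₁] at this
    omega
  have hqab := h.trans (hq.close h.toIsThin hiab hib) hcb
  have hab : b - a ≤ 2 * N := by omega
  have hN' : D ≤ 2 * N := by omega
  have hcab := h.out (2 * N) (h.mono hca hN') (h.mono (hP.close (ha.trans hvb) hbk) hab) hqab
  have hlen : ib ≤ ia + 2 ^ e := by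
    have := hq.le hiab hib (h.inn (A * (2 * N + 1) + D) (h.mono hcab (by omega))
      (h.mono hcb (by omega)) (hq.close h.toIsThin hiab hib))
    omega
  obtain ⟨l₁, G₁, hG₁, hG₁0, hG₁l⟩ := h.geod hca
  obtain ⟨l₂, G₂, hG₂, hG₂0, hG₂l⟩ := h.geod hqab
  obtain ⟨l₃, G₃, hG₃, hG₃0, hG₃l⟩ := h.geod (hq.close h.toIsThin hiab hib)
  obtain ⟨l₄, G₄, hG₄, hG₄0, hG₄l⟩ := h.geod hcb
  have hPs := hP.shift a (l := b - a) (by omega)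
  have htri := hK hPs hG₁ hG₂ (by simpa using hG₁0.symm) (hG₁l.trans hG₂0.symm)
    (by rw [hG₂l]; congr 1; omega) (v - a) (by omega)
  rw [Nat.add_sub_of_le ha] at htri
  -- By the size of `N`, `P v` is not close to a connecting geodesic `G₁` or `G₄` at an end that is
  -- not cut off; at a cut-off end that geodesic is a single vertex of `q`. What remains is `G₃`,
  -- where the logarithmic bound is below `D`.
  rcases htri with ⟨j, hj, hc⟩ | ⟨j, hj, hc⟩
  · rcases hta with ⟨hPa, rfl⟩ | hta
    · have : l₁ ≤ 0 := hG₁.le (Nat.zero_le l₁) le_rfl (by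
        rw [hG₁0, hG₁l, hPa]; exact h.refl _)
      rw [show j = 0 by omega, hG₁0, hPa] at hc
      exact ⟨0, Nat.zero_le _, h.mono hc (by omega)⟩
    · have h1 : l₁ ≤ D := hG₁.le (Nat.zero_le l₁) le_rfl (by rw [hG₁0, hG₁l]; exact hca)
      have h2 := hG₁.close (Nat.zero_le j) hj
      rw [hG₁0] at h2
      have h3 := hP.le ha hv (h.trans h2 hc)
      omega
  · rcases hK hG₂ hG₃ hG₄ (hG₂0.trans hG₃0.symm) (hG₃l.trans hG₄0.symm) (hG₂l.trans hG₄l.symm) j hj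
      with ⟨t, ht', hc'⟩ | ⟨t, ht', hc'⟩
    · obtain ⟨s, hs1, hs2, hs⟩ := hK' L q e ia ib hiab hlen (fun t _ h2 => hq.step t (by omega))
        l₃ G₃ hG₃ hG₃0 hG₃l t ht'
      exact ⟨s, hs2.trans hib, h.mono (h.trans (h.trans hs hc') hc) (by omega)⟩
    · have hc2 := h.trans hc' hc
      rcases htb with ⟨hPb, rfl⟩ | htb
      · have : l₄ ≤ 0 := hG₄.le (Nat.zero_le l₄) le_rfl (by
          rw [hG₄0, hG₄l, hPb]; exact h.refl _)
        rw [show t = 0 by omega, hG₄0] at hc2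
        exact ⟨ib, le_rfl, h.mono hc2 (by omega)⟩
      · have h1 : l₄ ≤ D := hG₄.le (Nat.zero_le l₄) le_rfl (by rw [hG₄0, hG₄l]; exact hcb)
        have h2 := hG₄.close ht' le_rfl
        rw [hG₄l] at h2
        have h3 := hP.le hvb hbk (h.out (2 * K + D) (h.mono hc2 (by omega)) (h.mono h2 (by omega))
          (hP.close hvb hbk))
        omega

/-- Geodesics are tracked by quasi-geodesics with the same end vertices. -/
lemma IsHyp.exists_isTracked (h : IsHyp c δ A) (L : ℕ) : ∃ D, ∀ {k n : ℕ} {P q : ℕ → V},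
    IsQuasiGeod c L n q → IsGeod c k P → P 0 = q 0 → P k = q n → IsTracked c D k n P q := by
  obtain ⟨D₁, hD₁⟩ := h.exists_improve L
  obtain ⟨D₂, hD₂⟩ := h.reverse.exists_improve L
  refine ⟨D₁ + D₂, fun {k n P q} hq hP h0 hk => ?_⟩
  have hdown : ∀ t, IsTracked c (D₁ + D₂ + t) k n P q → IsTracked c (D₁ + D₂) k n P q := by
    intro t
    induction t with
    | zero => exact id
    | succ t ih =>
      intro ht
      refine ih ⟨h0, hk, fun w hw => hD₁ (D₁ + D₂ + (t + 1)) (by omega) hq hP ht w hw,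
        fun w hw => ?_⟩
      obtain ⟨i, -, hc⟩ := hD₂ (D₁ + D₂ + (t + 1)) (by omega) hq.reverse hP.reverse ht.reverse
        (k - w) (by omega)
      rw [show k - (k - w) = w by omega] at hc
      exact ⟨n - i, Nat.sub_le _ _, hc⟩
  -- Tracking holds trivially at a radius depending on `k`, with the end vertices as centres; the
  -- descent ends at a radius free of `k`.
  refine hdown k ⟨h0, hk, fun w hw => ⟨0, Nat.zero_le _, ?_⟩, fun w hw => ⟨n, le_rfl, ?_⟩⟩
  · rw [← h0]
    exact h.mono (hP.close (Nat.zero_le w) hw) (by omega)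
  · rw [← hk]
    exact h.mono (hP.close hw le_rfl) (by omega)

/-- Sweeping along `P`, the tracking index passes over `i` at some edge. By (B1) the jump is
bounded, so `q i` is reached along `q` from the index before it. -/
lemma IsHyp.exists_cover_aux (h : IsHyp c δ A) (L D : ℕ) : ∃ K, ∀ {k n : ℕ} {P q : ℕ → V},
    IsQuasiGeod c L n q → IsGeod c k P → IsTracked c D k n P q →
    ∀ i ≤ n, ∃ w ≤ k, c (P w) (q i) K := by
  obtain ⟨E, hE⟩ : ∃ E, E = L * (A * (D + 2) + 1) := ⟨_, rfl⟩
  refine ⟨D + L * E, fun {k n P q} hq hP ht i hi => ?_⟩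
  have key : ∀ w ≤ k, ∀ j ≤ i, ∀ j' ≤ n, i ≤ j' → c (P w) (q j) D → c (P w) (q j') (D + 1) →
      ∃ w ≤ k, c (P w) (q i) (D + L * E) := by
    intro w hw j hj j' hj' hij h1 h2
    have hd := hq.le_of_out h (D + 1) (hj.trans hij) hj' (h.mono h1 (by omega)) h2
    rw [show D + 1 + 1 = D + 2 by ring, ← hE] at hd
    have : L * (i - j) ≤ L * E := Nat.mul_le_mul_left _ (by omega)
    exact ⟨w, hw, h.mono (h.trans h1 (hq.close h.toIsThin hj hi)) (by omega)⟩
  rcases exists_step (p := fun w => ∃ j ≤ i, c (P w) (q j) D)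
    ⟨0, Nat.zero_le _, h.mono (ht.first ▸ h.refl _) (Nat.zero_le _)⟩ k
    with ⟨j, hj, hc⟩ | ⟨w, hw, ⟨j, hj, hc⟩, hn⟩
  · exact key k le_rfl j hj n le_rfl hi hc (h.mono (ht.last ▸ h.refl _) (Nat.zero_le _))
  · obtain ⟨j', hj', hc'⟩ := ht.inn (w + 1) hw
    have hlt : i < j' := by
      by_contra hcon
      exact hn ⟨j', by omega, hc'⟩
    have h1 := h.trans (hP.close w.le_succ hw) hc'
    exact key w hw.le j hj j' hj' hlt.le hc (h.mono h1 (by omega))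

/-- Geodesics and quasi-geodesics with the same end vertices are close to each other. -/
lemma IsHyp.exists_stable (h : IsHyp c δ A) (L : ℕ) : ∃ K, ∀ {k n : ℕ} {P q : ℕ → V},
    IsQuasiGeod c L n q → IsGeod c k P → P 0 = q 0 → P k = q n →
    (∀ w ≤ k, ∃ i ≤ n, c (q i) (P w) K) ∧ (∀ w ≤ k, ∃ i ≤ n, c (P w) (q i) K) ∧
    (∀ i ≤ n, ∃ w ≤ k, c (P w) (q i) K) ∧ ∀ i ≤ n, ∃ w ≤ k, c (q i) (P w) K := by
  obtain ⟨D, hD⟩ := h.exists_isTracked L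
  obtain ⟨K₁, hK₁⟩ := h.exists_cover_aux L D
  obtain ⟨K₂, hK₂⟩ := h.reverse.exists_cover_aux L D
  refine ⟨D + K₁ + K₂, fun {k n P q} hq hP h0 hk => ?_⟩
  have ht := hD hq hP h0 hk
  refine ⟨fun w hw => ?_, fun w hw => ?_, fun i hi => ?_, fun i hi => ?_⟩
  · obtain ⟨i, hi, hc⟩ := ht.out w hw
    exact ⟨i, hi, h.mono hc (by omega)⟩
  · obtain ⟨i, hi, hc⟩ := ht.inn w hw
    exact ⟨i, hi, h.mono hc (by omega)⟩
  · obtain ⟨w, hw, hc⟩ := hK₁ hq hP ht i hi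
    exact ⟨w, hw, h.mono hc (by omega)⟩
  · obtain ⟨w, -, hc⟩ := hK₂ hq.reverse hP.reverse ht.reverse (n - i) (Nat.sub_le _ _)
    rw [show n - (n - i) = i by omega] at hc
    exact ⟨k - w, Nat.sub_le _ _, h.mono (c := c) hc (by omega)⟩

end Stability

/-! ### Rays, anti-rays and limits of geodesics -/

section Rays

variable {V : Type*} {c : V → V → ℕ → Prop} {δ A : ℕ}

/-- All initial segments of `S` are geodesics. -/
def IsGeodRay (c : V → V → ℕ → Prop) (S : ℕ → V) : Prop := ∀ k, IsGeod c k S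

/-- The sequence eventually leaves every out-ball and every in-ball. -/
def IsProper (c : V → V → ℕ → Prop) (X : ℕ → V) : Prop :=
  ∀ (x : V) (r : ℕ), ∃ N, ∀ i ≥ N, ¬ c x (X i) r ∧ ¬ c (X i) x r

/-- All vertices of the sequence are reachable from its first vertex, or the first vertex is
reachable from all of them. -/
def IsBased (c : V → V → ℕ → Prop) (X : ℕ → V) : Prop :=
  (∀ i, ∃ n, c (X 0) (X i) n) ∨ ∀ i, ∃ n, c (X i) (X 0) n

/-- Arbitrarily late vertices of `Y` are within bounded distance from late vertices of `X`. -/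
def FreqLE (c : V → V → ℕ → Prop) (X Y : ℕ → V) : Prop :=
  ∃ M, ∀ N, ∃ i ≥ N, ∃ j ≥ N, c (X i) (Y j) M

/-- All late vertices of `Y` are within bounded distance from `X`. -/
def Covers (c : V → V → ℕ → Prop) (X Y : ℕ → V) : Prop :=
  ∃ K N, ∀ m ≥ N, ∃ k, c (X k) (Y m) K

/-- Each of the two sequences lies in a bounded out-neighbourhood and in a bounded
in-neighbourhood of the other. -/
def IsNear (c : V → V → ℕ → Prop) (X Y : ℕ → V) : Prop :=
  ∃ K, ∀ m, (∃ i, c (X i) (Y m) K) ∧ (∃ i, c (Y m) (X i) K) ∧ (∃ i, c (Y i) (X m) K) ∧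
    ∃ i, c (X m) (Y i) K

lemma IsProper.reverse {X : ℕ → V} (h : IsProper c X) : IsProper (rev c) X := fun x r => by
  obtain ⟨N, hN⟩ := h x r
  exact ⟨N, fun i hi => (hN i hi).symm⟩

lemma IsBased.reverse {X : ℕ → V} (h : IsBased c X) : IsBased (rev c) X := Or.symm h

lemma FreqLE.reverse {X Y : ℕ → V} (h : FreqLE c X Y) : FreqLE (rev c) Y X := by
  obtain ⟨M, hM⟩ := h
  refine ⟨M, fun N => ?_⟩
  obtain ⟨i, hi, j, hj, hc⟩ := hM N
  exact ⟨j, hj, i, hi, hc⟩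

lemma IsNear.reverse {X Y : ℕ → V} (h : IsNear c X Y) : IsNear (rev c) X Y := by
  obtain ⟨K, hK⟩ := h
  exact ⟨K, fun m => ⟨(hK m).2.1, (hK m).1, (hK m).2.2.2, (hK m).2.2.1⟩⟩

lemma IsNear.symm {X Y : ℕ → V} (h : IsNear c X Y) : IsNear c Y X := by
  obtain ⟨K, hK⟩ := h
  exact ⟨K, fun m => ⟨(hK m).2.2.1, (hK m).2.2.2, (hK m).1, (hK m).2.1⟩⟩

lemma IsNear.trans (h : IsThin c δ) {X Y Z : ℕ → V} (h₁ : IsNear c X Y) (h₂ : IsNear c Y Z) :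
    IsNear c X Z := by
  obtain ⟨K, hK⟩ := h₁
  obtain ⟨K', hK'⟩ := h₂
  refine ⟨K + K', fun m => ⟨?_, ?_, ?_, ?_⟩⟩
  · obtain ⟨i, hi⟩ := (hK' m).1
    obtain ⟨j, hj⟩ := (hK i).1
    exact ⟨j, h.trans hj hi⟩
  · obtain ⟨i, hi⟩ := (hK' m).2.1
    obtain ⟨j, hj⟩ := (hK i).2.1
    exact ⟨j, h.mono (h.trans hi hj) (by omega)⟩
  · obtain ⟨i, hi⟩ := (hK m).2.2.1
    obtain ⟨j, hj⟩ := (hK' i).2.2.1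
    exact ⟨j, h.mono (h.trans hj hi) (by omega)⟩
  · obtain ⟨i, hi⟩ := (hK m).2.2.2
    obtain ⟨j, hj⟩ := (hK' i).2.2.2
    exact ⟨j, h.trans hi hj⟩

lemma IsNear.covers {X Y : ℕ → V} (h : IsNear c X Y) : Covers c X Y := by
  obtain ⟨K, hK⟩ := h
  exact ⟨K, 0, fun m _ => (hK m).1⟩

lemma IsProper.exists_forall_lt {X : ℕ → V} (hX : IsProper c X) (x : ℕ → V)
    (n r : ℕ) : ∃ N, ∀ i ≥ N, ∀ k < n, ¬ c (x k) (X i) r ∧ ¬ c (X i) (x k) r := by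
  induction n with
  | zero => exact ⟨0, fun i _ k hk => absurd hk (Nat.not_lt_zero k)⟩
  | succ n ih =>
    obtain ⟨N, hN⟩ := ih
    obtain ⟨N', hN'⟩ := hX (x n) r
    refine ⟨N + N', fun i hi k hk => ?_⟩
    rcases Nat.lt_succ_iff_lt_or_eq.mp hk with hk | rfl
    · exact hN i (by omega) k hk
    · exact hN' i (by omega)

/-- Late vertices of `Z` are out of bounded reach of the finitely many early vertices of `X`, so the
covering vertices are themselves late. -/
lemma Covers.freqLE (h : IsThin c δ) {X Y Z : ℕ → V} (hZ : IsProper c Z) (h₁ : Covers c X Y)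
    (h₂ : FreqLE c Y Z) : FreqLE c X Z := by
  obtain ⟨K, N₀, hK⟩ := h₁
  obtain ⟨M, hM⟩ := h₂
  refine ⟨K + M, fun N => ?_⟩
  obtain ⟨N₁, hN₁⟩ := hZ.exists_forall_lt X N (K + M)
  obtain ⟨m, hm, l, hl, hc⟩ := hM (N₀ + N₁ + N)
  obtain ⟨k, hk⟩ := hK m (by omega)
  refine ⟨k, ?_, l, by omega, h.trans hk hc⟩
  by_contra hcon
  exact (hN₁ l (by omega) k (by omega)).1 (h.trans hk hc)

lemma IsNear.freqLE_left (h : IsThin c δ) {X Y Z : ℕ → V} (hZ : IsProper c Z)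
    (hn : IsNear c X Y) : FreqLE c X Z ↔ FreqLE c Y Z :=
  ⟨hn.symm.covers.freqLE h hZ, hn.covers.freqLE h hZ⟩

lemma IsNear.freqLE_right (h : IsThin c δ) {X Y Z : ℕ → V} (hZ : IsProper c Z)
    (hn : IsNear c X Y) : FreqLE c Z X ↔ FreqLE c Z Y :=
  ⟨fun hF => (hn.symm.reverse.covers.freqLE h.reverse hZ.reverse hF.reverse).reverse,
    fun hF => (hn.reverse.covers.freqLE h.reverse hZ.reverse hF.reverse).reverse⟩

lemma IsGeodRay.isProper (h : IsHyp c δ A) {S : ℕ → V} (hS : IsGeodRay c S) : IsProper c S := by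
  have hout : ∀ (x : V) (r : ℕ), ∃ N, ∀ i ≥ N, ¬ c x (S i) r := by
    intro x r
    by_cases hex : ∃ i, c x (S i) r
    · obtain ⟨i₀, hi₀⟩ := hex
      refine ⟨i₀ + A * (r + 1) + 1, fun i hi hc => ?_⟩
      have := (hS i).le (by omega) le_rfl (h.out r hi₀ hc ((hS i).close (by omega) le_rfl))
      omega
    · exact ⟨0, fun i _ hc => hex ⟨i, hc⟩⟩
  have hinn : ∀ (x : V) (r : ℕ), ∃ N, ∀ i ≥ N, ¬ c (S i) x r := by
    intro x r
    by_cases hex : ∃ i, c (S i) x r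
    · obtain ⟨i₀, hi₀⟩ := hex
      refine ⟨i₀ + A * (r + 1) + 1, fun i hi hc => ?_⟩
      have := (hS i).le (by omega) le_rfl (h.inn r hi₀ hc ((hS i).close (by omega) le_rfl))
      omega
    · exact ⟨0, fun i _ hc => hex ⟨i, hc⟩⟩
  intro x r
  obtain ⟨N, hN⟩ := hout x r
  obtain ⟨N', hN'⟩ := hinn x r
  exact ⟨N + N', fun i hi => ⟨hN i (by omega), hN' i (by omega)⟩⟩

lemma IsGeodRay.injective (hc : ∀ x, c x x 0) {R : ℕ → V}
    (h : IsGeodRay c R) : Function.Injective R := by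
  intro i j hij
  have key : ∀ i j, i ≤ j → R i = R j → i = j := fun i j hle he => by
    have := (h j).le hle le_rfl (n := 0) (by rw [he]; exact hc _)
    omega
  rcases le_total i j with hle | hle
  · exact key i j hle hij
  · exact (key j i hle hij.symm).symm

lemma IsGeodRay.isBased {S : ℕ → V} (hS : IsGeodRay c S) : IsBased c S :=
  Or.inl fun i => ⟨_, (hS i).close (Nat.zero_le i) le_rfl⟩

lemma IsGeodRay.segment {S : ℕ → V} (hS : IsGeodRay c S) {i j : ℕ} (hij : i ≤ j) :
    IsGeod c (j - i) (fun t => S (i + t)) :=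
  (hS j).shift i (by omega)

/-- Take a geodesic `G` from `R i₁` to a very late `S j₂`. It fellow-travels with `S` backwards from
their common end, and by thinness it is reached from `R` except near the short link from `R i₂` to
`S j₂`; (B1) and the size of `j₂` keep `S m` away from that exception. -/
lemma IsGeodRay.covers_of_ray (h : IsHyp c δ A) {R S : ℕ → V} (hR : IsGeodRay c R)
    (hS : IsGeodRay c S) (hRS : FreqLE c R S) : Covers c R S := by
  obtain ⟨M, hM⟩ := hRS
  obtain ⟨K, hK⟩ := h.reverse.exists_fellow M
  obtain ⟨i₁, -, j₁, -, h₁⟩ := hM 0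
  refine ⟨δ + K, j₁, fun m hm => ?_⟩
  obtain ⟨i₂, hi₂, j₂, hj₂, h₂⟩ := hM (i₁ + m + A * (K + (δ + M) + 1) + 1)
  obtain ⟨t, G, hG, hG0, hGt⟩ := h.geod (h.trans h₁ ((hS j₂).close (i := j₁) (by omega) le_rfl))
  obtain ⟨s, H, hH, hH0, hHs⟩ := h.geod h₂
  have hs : s ≤ M := hH.le (Nat.zero_le s) le_rfl (by rw [hH0, hHs]; exact h₂)
  obtain ⟨w, -, hw⟩ := (hK hG.reverse (hS.segment (i := j₁) (j := j₂) (by omega)).reverse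
    (by simp only [Nat.sub_zero, hGt]; congr 1; omega)
    (by simpa [hG0, rev] using h₁)).2.2 (j₂ - m) (by omega)
  rw [show j₁ + (j₂ - j₁ - (j₂ - m)) = m by omega] at hw
  replace hw : c (G (t - w)) (S m) K := hw
  rcases h.thin_long hG (hR.segment (i := i₁) (j := i₂) (by omega)) hH hG0
    (by rw [hH0]; congr 1; omega) (hGt.trans hHs.symm) (t - w) (Nat.sub_le _ _)
    with ⟨k, -, hk⟩ | ⟨k, hk', hk⟩
  · exact ⟨i₁ + k, h.trans hk hw⟩
  · have h3 := h.trans hk (hH.close hk' le_rfl)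
    rw [hHs] at h3
    have := (hS j₂).le (i := m) (by omega) le_rfl (h.out (K + (δ + M)) (h.mono hw (by omega))
      (h.mono h3 (by omega)) ((hS j₂).close (by omega) le_rfl))
    omega

/-- Now the directed path runs from `R i₂` back to `R i₁`, and short links lead to `S j₂` and `S
j₁`. Two thin triangles place `S m` close to `R` unless a link is involved; that would make `m` too
close to `j₂` or `j₁`. -/
lemma IsGeodRay.covers_of_antiRay (h : IsHyp c δ A) {R S : ℕ → V} (hR : IsGeodRay (rev c) R)
    (hS : IsGeodRay c S) (hRS : FreqLE c R S) : Covers c R S := by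
  obtain ⟨M, hM⟩ := hRS
  obtain ⟨i₁, -, j₁, -, h₁⟩ := hM 0
  refine ⟨δ + δ, j₁ + A * (δ + M + 1) + 1, fun m hm => ?_⟩
  obtain ⟨i₂, hi₂, j₂, hj₂, h₂⟩ := hM (i₁ + m + δ + M + 1)
  have hRR : c (R i₂) (R i₁) (i₂ - i₁) := (hR i₂).close (by omega) le_rfl
  obtain ⟨t, G, hG, hG0, hGt⟩ := h.geod (h.trans hRR h₁)
  obtain ⟨s, H, hH, hH0, hHs⟩ := h.geod h₂
  obtain ⟨u, E, hE, hE0, hEu⟩ := h.geod h₁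
  have hs : s ≤ M := hH.le (Nat.zero_le s) le_rfl (by rw [hH0, hHs]; exact h₂)
  have hu : u ≤ M := hE.le (Nat.zero_le u) le_rfl (by rw [hE0, hEu]; exact h₁)
  have hw := h.thin_second hH hG (hS.segment (i := j₁) (j := j₂) (by omega))
    (hH0.trans hG0.symm) hGt (by rw [hHs]; congr 1; omega) (m - j₁) (by omega)
  rw [show j₁ + (m - j₁) = m by omega] at hw
  rcases hw with ⟨w, hwt, hw⟩ | ⟨w, hws, hw⟩
  · have hRseg : IsGeod c (i₂ - i₁) (fun s => R (i₁ + (i₂ - i₁ - s))) :=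
      (hR.segment (i := i₁) (j := i₂) (by omega)).reverse
    rcases h.thin_long hG hRseg hE (by rw [hG0]; congr 1; omega) (by simp [hE0])
      (hGt.trans hEu.symm) w hwt with ⟨k, -, hk⟩ | ⟨k, hk', hk⟩
    · exact ⟨_, h.trans hk hw⟩
    · have h3 := h.trans hk (hE.close hk' le_rfl)
      rw [hEu] at h3
      have := (hS m).le (i := j₁) (by omega) le_rfl (h.out (δ + M) (h.mono h3 (by omega))
        (h.mono hw (by omega)) ((hS m).close (by omega) le_rfl))
      omega
  · have h3 := h.trans hw (hH.close hws le_rfl)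
    rw [hHs] at h3
    have := (hS j₂).le (i := m) (by omega) le_rfl h3
    omega

/-- Transitivity of `FreqLE` among geodesic rays and anti-rays. -/
lemma FreqLE.trans (h : IsHyp c δ A) {R S T : ℕ → V}
    (hR : IsGeodRay c R ∨ IsGeodRay (rev c) R) (hS : IsGeodRay c S ∨ IsGeodRay (rev c) S)
    (hT : IsGeodRay c T ∨ IsGeodRay (rev c) T) (hRS : FreqLE c R S) (hST : FreqLE c S T) :
    FreqLE c R T := by
  have hproper : ∀ {X : ℕ → V}, IsGeodRay c X ∨ IsGeodRay (rev c) X → IsProper c X :=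
    fun hX => hX.elim (fun hX => hX.isProper h) fun hX => (hX.isProper h.reverse).reverse
  -- The direction of the middle sequence decides: a ray `S` is covered by `R`, while an anti-ray is
  -- covered by `T` in the reversed relation.
  rcases hS with hS | hS
  · have hcov : Covers c R S := hR.elim (fun hR => hR.covers_of_ray h hS hRS)
      fun hR => hR.covers_of_antiRay h hS hRS
    exact hcov.freqLE h.toIsThin (hproper hT) hST
  · have hcov : Covers (rev c) T S :=
      hT.elim (fun hT => IsGeodRay.covers_of_antiRay h.reverse hT hS hST.reverse)
        fun hT => hT.covers_of_ray h.reverse hS hST.reverse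
    exact (hcov.freqLE h.toIsThin.reverse (hproper hR).reverse hRS.reverse).reverse

/-- A quasi-geodesic ray is near a geodesic ray if out-degrees are finite. -/
lemma IsHyp.exists_isNear (h : IsHyp c δ A) (hfin : ∀ x, {y | c x y 1}.Finite) {L : ℕ}
    {q : ℕ → V} (hq : ∀ n, IsQuasiGeod c L n q) : ∃ S, IsGeodRay c S ∧ IsNear c q S := by
  obtain ⟨K, hK⟩ := h.exists_stable L
  have hex : ∀ n, ∃ k P, IsGeod c k P ∧ P 0 = q 0 ∧ P k = q n := fun n =>
    h.geod ((hq n).close h.toIsThin (Nat.zero_le n) le_rfl)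
  choose ℓ P hP hP0 hPl using hex
  have hst := fun n => hK (hq n) (hP n) (hP0 n) (hPl n)
  have hlarge : ∀ m, ∀ᶠ n in Filter.hyperfilter ℕ, m ≤ ℓ n ∧ m ≤ n := by
    intro m
    refine Filter.Eventually.filter_mono Nat.hyperfilter_le_atTop ?_
    filter_upwards [Filter.eventually_gt_atTop (L * (m + 1)), Filter.eventually_ge_atTop m]
      with n hn hnm
    refine ⟨?_, hnm⟩
    by_contra hcon
    have h1 := (hP n).close (Nat.zero_le (ℓ n)) le_rfl
    rw [hP0, hPl] at h1
    have h2 := (hq n).le (Nat.zero_le n) le_rfl (h.mono h1 (show ℓ n - 0 ≤ m by omega))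
    omega
  -- Once the `m`-th vertices agree for almost all `n`, the next ones lie in a finite set, and the
  -- ultrafilter selects one value. This replaces a diagonal argument.
  have hlim : ∀ m, ∃ s, ∀ᶠ n in Filter.hyperfilter ℕ, P n m = s := by
    intro m
    induction m with
    | zero => exact ⟨q 0, Filter.Eventually.of_forall hP0⟩
    | succ m ih =>
      obtain ⟨s, hs⟩ := ih
      have hmem : ∀ᶠ n in Filter.hyperfilter ℕ, ∃ y ∈ {y | c s y 1}, P n (m + 1) = y := by
        filter_upwards [hs, hlarge (m + 1)] with n hn hl
        have := (hP n).close m.le_succ hl.1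
        rw [hn, show m.succ - m = 1 by omega] at this
        exact ⟨_, this, rfl⟩
      obtain ⟨y, -, hy⟩ := (Ultrafilter.eventually_exists_mem_iff (hfin s)).mp hmem
      exact ⟨y, hy⟩
  choose S hS using hlim
  refine ⟨S, fun k i j hij hj => ?_, K, fun m => ⟨?_, ?_, ?_, ?_⟩⟩
  · obtain ⟨n, h1, h2, h3⟩ := ((hS i).and ((hS j).and (hlarge j))).exists
    have := hP n i j hij h3.1
    rwa [h1, h2] at this
  · obtain ⟨n, h1, h2⟩ := ((hS m).and (hlarge m)).exists
    obtain ⟨i, -, hc⟩ := (hst n).1 m h2.1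
    exact ⟨i, h1 ▸ hc⟩
  · obtain ⟨n, h1, h2⟩ := ((hS m).and (hlarge m)).exists
    obtain ⟨i, -, hc⟩ := (hst n).2.1 m h2.1
    exact ⟨i, h1 ▸ hc⟩
  -- The index on `P n` of a vertex close to `q m` is bounded independently of `n`, here by (B2) and
  -- in the last case by the triangle inequality. So `P n` need agree with `S` only on a finite
  -- segment.
  · have hall : ∀ᶠ n in Filter.hyperfilter ℕ,
        ∀ w ∈ Set.Iic (A * (K + L * m + 1)), P n w = S w :=
      (Filter.eventually_all_finite (Set.finite_Iic _)).mpr fun w _ => hS w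
    obtain ⟨n, h1, h2⟩ := (hall.and (hlarge m)).exists
    obtain ⟨w, hw, hc⟩ := (hst n).2.2.1 m h2.2
    have h3 := (hq m).close h.toIsThin (Nat.zero_le m) le_rfl
    have h4 := (hP n).close (Nat.zero_le w) hw
    rw [← hP0 n] at h3
    have h5 := (hP n).le (Nat.zero_le w) hw
      (h.inn (K + L * m) (h.mono h3 (by rw [Nat.sub_zero]; omega)) (h.mono hc (by omega)) h4)
    exact ⟨w, h1 w (by rw [Set.mem_Iic]; omega) ▸ hc⟩
  · have hall : ∀ᶠ n in Filter.hyperfilter ℕ, ∀ w ∈ Set.Iic (L * m + K), P n w = S w :=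
      (Filter.eventually_all_finite (Set.finite_Iic _)).mpr fun w _ => hS w
    obtain ⟨n, h1, h2⟩ := (hall.and (hlarge m)).exists
    obtain ⟨w, hw, hc⟩ := (hst n).2.2.2 m h2.2
    have h3 := (hq m).close h.toIsThin (Nat.zero_le m) le_rfl
    rw [← hP0 n] at h3
    have h5 := (hP n).le (Nat.zero_le w) hw (h.trans h3 hc)
    exact ⟨w, h1 w (by rw [Set.mem_Iic]; omega) ▸ hc⟩

end Rays

/-! ### Quasi-isometries and quasi-inverses -/

section QuasiIsometry

variable {V W : Type*} {c₁ : V → V → ℕ → Prop} {c₂ : W → W → ℕ → Prop} {δ₁ A₁ δ₂ A₂ G : ℕ}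
  {f : V → W}

/-- `f` is a quasi-isometry between distance relations, with all constants bounded by `G`. -/
structure IsCoarseEquiv (c₁ : V → V → ℕ → Prop) (c₂ : W → W → ℕ → Prop) (f : V → W) (G : ℕ) :
    Prop where
  up : ∀ {x y n}, c₁ x y n → c₂ (f x) (f y) (G * (n + 1))
  down : ∀ {x y n}, c₂ (f x) (f y) n → c₁ x y (G * (n + 1))
  dense : ∀ y, ∃ x, c₂ (f x) y G ∧ c₂ y (f x) G

namespace IsCoarseEquiv

lemma reverse (hf : IsCoarseEquiv c₁ c₂ f G) : IsCoarseEquiv (rev c₁) (rev c₂) f G where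
  up := fun h => hf.up h
  down := fun h => hf.down h
  dense := fun y => (hf.dense y).imp fun _ h => h.symm

lemma isProper (h₂ : IsThin c₂ δ₂) (hf : IsCoarseEquiv c₁ c₂ f G) {X : ℕ → V}
    (hX : IsProper c₁ X) : IsProper c₂ (f ∘ X) := by
  intro y r
  obtain ⟨x, hxy, hyx⟩ := hf.dense y
  obtain ⟨N, hN⟩ := hX x (G * (G + r + 1))
  refine ⟨N, fun i hi => ⟨fun hc => (hN i hi).1 ?_, fun hc => (hN i hi).2 ?_⟩⟩
  · exact hf.down (h₂.trans hxy hc)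
  · exact hf.down (h₂.mono (h₂.trans hc hyx) (by omega))

lemma isBased (hf : IsCoarseEquiv c₁ c₂ f G) {X : ℕ → V} (hX : IsBased c₁ X) :
    IsBased c₂ (f ∘ X) :=
  hX.imp (fun h i => (h i).elim fun _ hn => ⟨_, hf.up hn⟩)
    fun h i => (h i).elim fun _ hn => ⟨_, hf.up hn⟩

lemma freqLE_iff (hf : IsCoarseEquiv c₁ c₂ f G) {X Y : ℕ → V} :
    FreqLE c₂ (f ∘ X) (f ∘ Y) ↔ FreqLE c₁ X Y := by
  constructor
  · rintro ⟨M, hM⟩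
    refine ⟨G * (M + 1), fun N => ?_⟩
    obtain ⟨i, hi, j, hj, hc⟩ := hM N
    exact ⟨i, hi, j, hj, hf.down hc⟩
  · rintro ⟨M, hM⟩
    refine ⟨G * (M + 1), fun N => ?_⟩
    obtain ⟨i, hi, j, hj, hc⟩ := hM N
    exact ⟨i, hi, j, hj, hf.up hc⟩

lemma isNear (hf : IsCoarseEquiv c₁ c₂ f G) {X Y : ℕ → V} (h : IsNear c₁ X Y) :
    IsNear c₂ (f ∘ X) (f ∘ Y) := by
  obtain ⟨K, hK⟩ := h
  exact ⟨_, fun m => ⟨(hK m).1.imp fun _ h => hf.up h, (hK m).2.1.imp fun _ h => hf.up h,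
    (hK m).2.2.1.imp fun _ h => hf.up h, (hK m).2.2.2.imp fun _ h => hf.up h⟩⟩

lemma isQuasiGeod (hf : IsCoarseEquiv c₁ c₂ f G) {R : ℕ → V}
    (hR : IsGeodRay c₁ R) (n : ℕ) : IsQuasiGeod c₂ (G * 2) n (f ∘ R) where
  step := fun i _ => by
    have := (hR (i + 1)).close i.le_succ le_rfl
    rw [show i.succ - i = 1 by omega] at this
    exact hf.up this
  le := fun {i j m} hij _ hc => by
    have := (hR j).le hij le_rfl (hf.down hc)
    rw [mul_assoc]
    exact this.trans (Nat.mul_le_mul_left _ (by omega))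

lemma exists_inverse (h₁ : IsThin c₁ δ₁) (h₂ : IsThin c₂ δ₂) (hf : IsCoarseEquiv c₁ c₂ f G) :
    ∃ g G', IsCoarseEquiv c₂ c₁ g G' ∧ ∀ y, c₂ (f (g y)) y G ∧ c₂ y (f (g y)) G := by
  choose g hg using hf.dense
  refine ⟨g, G * (2 * G + 1) + 3 * G, ⟨?_, ?_, ?_⟩, hg⟩
  · intro y y' n hc
    refine h₁.mono (hf.down (h₂.trans (hg y).1 (h₂.trans hc (hg y').2))) ?_
    nlinarith [Nat.zero_le (G * G * n), Nat.zero_le (G * n), Nat.zero_le (G * G)]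
  · intro y y' n hc
    refine h₂.mono (h₂.trans (hg y).2 (h₂.trans (hf.up hc) (hg y').1)) ?_
    nlinarith [Nat.zero_le (G * G * n), Nat.zero_le (G * n), Nat.zero_le (G * G)]
  · intro x
    have hle : G * (G + 1) ≤ G * (2 * G + 1) + 3 * G := by nlinarith
    exact ⟨f x, h₁.mono (hf.down (hg (f x)).1) hle, h₁.mono (hf.down (hg (f x)).2) hle⟩

lemma exists_ray_isNear (h₂ : IsHyp c₂ δ₂ A₂) (hfin : ∀ x, {y | c₂ x y 1}.Finite)
    (hf : IsCoarseEquiv c₁ c₂ f G) {R : ℕ → V} (hR : IsGeodRay c₁ R) :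
    ∃ S, IsGeodRay c₂ S ∧ IsNear c₂ (f ∘ R) S :=
  h₂.exists_isNear hfin (hf.isQuasiGeod hR)

/-- Pull `S` back by a quasi-inverse, straighten it to a geodesic ray there, and map forward; the
composite moves vertices only a bounded distance. -/
lemma exists_ray_image_isNear (h₁ : IsHyp c₁ δ₁ A₁) (h₂ : IsThin c₂ δ₂)
    (hfin : ∀ x, {y | c₁ x y 1}.Finite) (hf : IsCoarseEquiv c₁ c₂ f G) {S : ℕ → W}
    (hS : IsGeodRay c₂ S) : ∃ R, IsGeodRay c₁ R ∧ IsNear c₂ (f ∘ R) S := by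
  obtain ⟨g, G', hg, hfg⟩ := hf.exists_inverse h₁.toIsThin h₂
  obtain ⟨R, hR, hn⟩ := hg.exists_ray_isNear h₁ hfin hS
  refine ⟨R, hR, IsNear.trans h₂ (hf.isNear hn.symm) ⟨G, fun m => ?_⟩⟩
  exact ⟨⟨m, (hfg _).1⟩, ⟨m, (hfg _).2⟩, ⟨m, (hfg _).2⟩, ⟨m, (hfg _).1⟩⟩

end IsCoarseEquiv

end QuasiIsometry

/-! ### From digraphs to distance relations -/

section Digraph

variable {V : Type*} [Quiver V]

/-- The distance from `x` to `y` is at most `n`. -/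
def Within (x y : V) (n : ℕ) : Prop := ddist x y ≤ n

lemma within_iff {x y : V} {n : ℕ} :
    Within x y n ↔ ∃ k ≤ n, ∃ p : ℕ → V, IsDirectedPath k p ∧ p 0 = x ∧ p k = y := by
  constructor
  · intro h
    by_contra! hcon
    have h1 : ((n + 1 : ℕ) : ℝ≥0∞) ≤ ddist x y := by
      refine le_iInf₂ fun k ⟨p, hp, h0, hk⟩ => ?_
      rw [Nat.cast_le]
      by_contra hlt
      exact hcon k (by omega) p hp h0 hk
    have h2 := h1.trans h
    rw [Nat.cast_le] at h2
    omega
  · rintro ⟨k, hk, p, hp⟩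
    exact (iInf₂_le k ⟨p, hp⟩).trans (Nat.cast_le.mpr hk)

lemma le_ddist {x y : V} {k : ℕ} (h : ∀ n, Within x y n → k ≤ n) : (k : ℝ≥0∞) ≤ ddist x y :=
  le_iInf₂ fun n hn => Nat.cast_le.mpr (h n (within_iff.mpr ⟨n, le_rfl, hn⟩))

lemma within_refl (x : V) : Within x x 0 :=
  within_iff.mpr ⟨0, le_rfl, fun _ => x, fun _ hi => absurd hi (Nat.not_lt_zero _), rfl, rfl⟩

lemma Within.mono {x y : V} {m n : ℕ} (h : Within x y m) (hmn : m ≤ n) : Within x y n :=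
  le_trans h (Nat.cast_le.mpr hmn)

lemma Within.eq {x y : V} (h : Within x y 0) : x = y := by
  obtain ⟨k, hk, p, -, h0, h1⟩ := within_iff.mp h
  rw [← h0, ← h1, Nat.le_zero.mp hk]

lemma Within.adj {x y : V} (h : Within x y 1) (h0 : ¬ Within x y 0) : Adj x y := by
  obtain ⟨k, hk, p, hp, hx, hy⟩ := within_iff.mp h
  rcases Nat.le_one_iff_eq_zero_or_eq_one.mp hk with rfl | rfl
  · exact absurd (within_iff.mpr ⟨0, le_rfl, p, hp, hx, hy⟩) h0
  · rw [← hx, ← hy]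
    exact hp 0 Nat.one_pos

lemma IsDirectedPath.within {k : ℕ} {p : ℕ → V} (hp : IsDirectedPath k p) {i j : ℕ}
    (hij : i ≤ j) (hj : j ≤ k) : Within (p i) (p j) (j - i) :=
  within_iff.mpr ⟨j - i, le_rfl, fun t => p (i + t), fun t ht => hp (i + t) (by omega), rfl, by
    simp only; congr 1; omega⟩

lemma Within.trans {x y z : V} {m n : ℕ} (h₁ : Within x y m) (h₂ : Within y z n) :
    Within x z (m + n) := by
  obtain ⟨k, hk, p, hp, hp0, hpk⟩ := within_iff.mp h₁
  obtain ⟨l, hl, q, hq, hq0, hql⟩ := within_iff.mp h₂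
  refine within_iff.mpr ⟨k + l, by omega, fun i => if i ≤ k then p i else q (i - k), ?_, ?_, ?_⟩
  · intro i hi
    rcases lt_trichotomy i k with h | rfl | h
    · simpa [h.le, Nat.succ_le_of_lt h] using hp i h
    · have := hq 0 (by omega)
      rw [hq0, ← hpk] at this
      simpa using this
    · have := hq (i - k) (by omega)
      rw [show i - k + 1 = i + 1 - k by omega] at this
      simpa [show ¬ i ≤ k by omega, show ¬ i + 1 ≤ k by omega] using this
  · simpa using hp0
  · rcases Nat.eq_zero_or_pos l with rfl | h
    · simpa using hpk.trans (hq0.symm.trans hql)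
    · simpa [show ¬ l = 0 by omega] using hql

lemma Within.exists_isGeod {x y : V} {n : ℕ} (h : Within x y n) :
    ∃ k p, IsGeod Within k p ∧ p 0 = x ∧ p k = y := by
  classical
  have hex : ∃ k, ∃ p : ℕ → V, IsDirectedPath k p ∧ p 0 = x ∧ p k = y := by
    obtain ⟨k, -, hk⟩ := within_iff.mp h
    exact ⟨k, hk⟩
  obtain ⟨p, hp, hp0, hpk⟩ := Nat.find_spec hex
  refine ⟨Nat.find hex, p, fun i j hij hj => ⟨hp.within hij hj, fun m hm => ?_⟩, hp0, hpk⟩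
  have h1 := ((hp.within (Nat.zero_le i) (hij.trans hj)).trans hm).trans (hp.within hj le_rfl)
  rw [hp0, hpk] at h1
  obtain ⟨l, hl, hq⟩ := within_iff.mp h1
  have := Nat.find_min' hex hq
  omega

lemma ddist_eq_of_isGeod {k : ℕ} {p : ℕ → V} (h : IsGeod Within k p) : ddist (p 0) (p k) = k :=
  le_antisymm (h.close (Nat.zero_le k) le_rfl)
    (le_ddist fun n hn => by simpa using h.le (Nat.zero_le k) le_rfl hn)

lemma IsGeod.isGeodesic {k : ℕ} {p : ℕ → V} (h : IsGeod Within k p) : IsGeodesic k p := by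
  refine ⟨fun i hi => ?_, ddist_eq_of_isGeod h⟩
  have h1 := h.close i.le_succ hi
  rw [show i.succ - i = 1 by omega] at h1
  refine h1.adj fun h0 => ?_
  have := h.le i.le_succ hi h0
  omega

lemma IsDeltaHyperbolic.isThin {δ : ℝ≥0} (h : IsDeltaHyperbolic V δ) :
    IsThin (Within (V := V)) ⌈δ⌉₊ := by
  have hle : ∀ {x y : V}, ddist x y ≤ δ → Within x y ⌈δ⌉₊ := fun hxy =>
    hxy.trans (by exact_mod_cast Nat.le_ceil δ)
  have key : ∀ {x y z : V} {k l m : ℕ} {P Q R : ℕ → V}, IsGeod Within k P → IsGeod Within l Q →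
      IsGeod Within m R → P 0 = x → P k = y → IsBetween l Q x z → IsBetween m R y z →
      ∀ i ≤ k, (∃ j ≤ l, Within (Q j) (P i) ⌈δ⌉₊) ∨ ∃ j ≤ m, Within (P i) (R j) ⌈δ⌉₊ := by
    intro x y z k l m P Q R hP hQ hR h0 hk hQb hRb i hi
    exact (h x y z k l m P Q R hP.isGeodesic hQ.isGeodesic hR.isGeodesic h0 hk hQb hRb i hi).imp
      (fun ⟨j, hj, hc⟩ => ⟨j, hj, hle hc⟩) fun ⟨j, hj, hc⟩ => ⟨j, hj, hle hc⟩
  exact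
    { refl := within_refl
      mono := Within.mono
      trans := Within.trans
      geod := Within.exists_isGeod
      thin_long := fun {k l m P Q R} hP hQ hR h1 h2 h3 =>
        key (z := Q l) hP hQ hR rfl rfl (Or.inl ⟨h1.symm, rfl⟩) (Or.inr ⟨h2.symm, h3.symm⟩)
      thin_first := fun {k l m P Q R} hP hQ hR h1 h2 h3 =>
        key (z := P k) hQ hP hR rfl rfl (Or.inl ⟨h1, rfl⟩) (Or.inl ⟨h2.symm, h3.symm⟩)
      thin_second := fun {k l m P Q R} hP hQ hR h1 h2 h3 =>
        key (z := Q 0) hR hQ hP rfl rfl (Or.inr ⟨rfl, h2⟩) (Or.inr ⟨h1, h3⟩) }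

lemma IsHyperbolic.exists_isHyp (h : IsHyperbolic V) (h₁ : B1 (ddist (V := V)))
    (h₂ : B2 (ddist (V := V))) : ∃ δ A, IsHyp (Within (V := V)) δ A := by
  obtain ⟨δ, hδ⟩ := h
  obtain ⟨g₁, hg₁⟩ := h₁
  obtain ⟨g₂, hg₂⟩ := h₂
  have hball : ∀ {x y : V} {n : ℕ}, Within x y n → ddist x y ≤ ((n : ℝ≥0) : ℝ≥0∞) := by
    intro x y n hxy
    exact_mod_cast hxy
  have hle : ∀ {x y : V} {n : ℕ} {s t : ℝ≥0}, Within x y n →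
      (ddist x y = ∞ ∨ ddist x y ≤ s) → s ≤ t → Within x y ⌈t⌉₊ := by
    intro x y n s t hxy hor hst
    rcases hor with h | h
    · have : ddist x y ≤ n := hxy
      rw [h] at this
      exact absurd this (by simp)
    · exact h.trans (by exact_mod_cast hst.trans (Nat.le_ceil t))
  refine ⟨_, _, hδ.isThin.isHyp (g := ⌈g₁ ⌈δ⌉₊ + g₂ ⌈δ⌉₊⌉₊) ?_ ?_⟩
  · intro x y z n hxy hxz hyz
    exact hle hyz (hg₁ x ⌈δ⌉₊ y (hball hxy) z (hball hxz)) le_self_add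
  · intro x y z n hyx hzx hyz
    exact hle hyz (hg₂ x ⌈δ⌉₊ y (hball hyx) z (hball hzx)) le_add_self

lemma FiniteOutDegree.finite (h : FiniteOutDegree V) (x : V) : {y : V | Within x y 1}.Finite := by
  refine ((h x).insert x).subset fun y hy => ?_
  by_cases h0 : Within x y 0
  · exact Or.inl h0.eq.symm
  · have hy' : ddist x y ≤ (1 : ℕ) := hy
    refine Or.inr (le_antisymm (by simpa using hy') ?_)
    have := le_ddist (x := x) (y := y) (k := 1) fun n hn => by
      by_contra hlt
      exact h0 (hn.mono (by omega))
    simpa using this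

lemma FiniteInDegree.finite (h : FiniteInDegree V) (x : V) :
    {y : V | rev Within x y 1}.Finite := by
  refine ((h x).insert x).subset fun y hy => ?_
  by_cases h0 : Within y x 0
  · exact Or.inl h0.eq
  · have hy' : ddist y x ≤ (1 : ℕ) := hy
    refine Or.inr (le_antisymm (by simpa using hy') ?_)
    have := le_ddist (x := y) (y := x) (k := 1) fun n hn => by
      by_contra hlt
      exact h0 (hn.mono (by omega))
    simpa using this

lemma within_iff_of_ddist_eq {x y : V} {k n : ℕ} (h : ddist x y = k) : Within x y n ↔ k ≤ n := by
  rw [Within, h, Nat.cast_le]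

lemma isGeodRay_of_mem {R : ℕ → V} (h : R ∈ geodesicRays V) : IsGeodRay Within R :=
  fun k i j hij hj => by
    have := h.2 i (j - i)
    rw [Nat.add_sub_of_le hij] at this
    exact ⟨(within_iff_of_ddist_eq this).mpr le_rfl, fun n => (within_iff_of_ddist_eq this).mp⟩

lemma isGeodRay_of_mem_antiRays {R : ℕ → V} (h : R ∈ geodesicAntiRays V) :
    IsGeodRay (rev Within) R :=
  fun k i j hij hj => by
    have := h.2 i (j - i)
    rw [Nat.add_sub_of_le hij] at this
    exact ⟨(within_iff_of_ddist_eq this).mpr le_rfl, fun n => (within_iff_of_ddist_eq this).mp⟩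

lemma IsGeodRay.mem_geodesicRays {R : ℕ → V} (h : IsGeodRay Within R) : R ∈ geodesicRays V := by
  refine ⟨⟨h.injective within_refl, fun i => (h (i + 1)).isGeodesic.1 i i.lt_succ_self⟩,
    fun i k => ?_⟩
  simpa using ddist_eq_of_isGeod ((h (i + k)).shift i le_rfl)

lemma IsGeodRay.mem_geodesicAntiRays {R : ℕ → V} (h : IsGeodRay (rev Within) R) :
    R ∈ geodesicAntiRays V := by
  refine ⟨⟨IsGeodRay.injective (c := rev Within) within_refl h, fun i => ?_⟩, fun i k => ?_⟩
  · simpa using (h (i + 1)).reverse.isGeodesic.1 0 i.succ_pos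
  · have h1 : IsGeod Within k (fun t => R (i + (k - t))) :=
      ((h (i + k)).shift i (l := k) le_rfl).reverse
    simpa using ddist_eq_of_isGeod h1

/-- For proper sequences, the relation `≤` says that vertices arbitrarily far out on both
sequences are within bounded distance. -/
lemma rayLE_iff {R S : ℕ → V} (hR : IsProper Within R) (hR' : IsBased Within R)
    (hS : IsProper Within S) : RayLE R S ↔ FreqLE Within R S := by
  constructor
  · rintro ⟨M, hM⟩
    refine ⟨M, fun N => ?_⟩
    -- Late vertices of `R` are not within `M` of early vertices of `S`, so it suffices to make the
    -- index on `R` late.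
    obtain ⟨N', hN'⟩ := hR.exists_forall_lt S N M
    have hfar : ∀ N, ∃ i ≥ N, ∃ j, Within (R i) (S j) M := by
      intro N
      -- Basedness supplies finite distances between `R 0` and the early vertices of `R`, so one
      -- ball around `R 0` traps every path starting early: through its last vertex for out-balls,
      -- whence the added `M`, and through its first for in-balls.
      rcases hR' with hb | hb
      · choose n hn using hb
        obtain ⟨k, p, hp, hk, ⟨i, hi⟩, ⟨j, hj⟩, hav⟩ :=
          hM ((∑ t ∈ Finset.range N, n t + M : ℕ) : ℝ≥0) (R 0)
        have hij : Within (R i) (S j) M := by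
          rw [hi, hj]
          exact (hp.within (Nat.zero_le k) le_rfl).mono (by omega)
        refine ⟨i, ?_, j, hij⟩
        by_contra hlt
        refine hav k le_rfl (Or.inl ?_)
        have hs : n i ≤ ∑ t ∈ Finset.range N, n t :=
          Finset.single_le_sum (fun _ _ => Nat.zero_le _) (Finset.mem_range.mpr (by omega))
        have hw : ddist (R 0) (p k) ≤ ((∑ t ∈ Finset.range N, n t + M : ℕ) : ℝ≥0∞) := by
          rw [← hj]
          exact ((hn i).trans hij).mono (by omega)
        exact_mod_cast hw
      · choose n hn using hb
        obtain ⟨k, p, hp, hk, ⟨i, hi⟩, ⟨j, hj⟩, hav⟩ :=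
          hM ((∑ t ∈ Finset.range N, n t : ℕ) : ℝ≥0) (R 0)
        refine ⟨i, ?_, j, ?_⟩
        · by_contra hlt
          refine hav 0 (Nat.zero_le k) (Or.inr ?_)
          have hs : n i ≤ ∑ t ∈ Finset.range N, n t :=
            Finset.single_le_sum (fun _ _ => Nat.zero_le _) (Finset.mem_range.mpr (by omega))
          have hw : ddist (p 0) (R 0) ≤ ((∑ t ∈ Finset.range N, n t : ℕ) : ℝ≥0∞) := by
            rw [← hi]
            exact (hn i).mono hs
          exact_mod_cast hw
        · rw [hi, hj]
          exact (hp.within (Nat.zero_le k) le_rfl).mono (by omega)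
    obtain ⟨i, hi, j, hc⟩ := hfar (N + N')
    refine ⟨i, by omega, j, ?_, hc⟩
    by_contra hlt
    exact (hN' i (by omega) j (by omega)).2 hc
  · rintro ⟨M, hM⟩
    refine ⟨M, fun r x => ?_⟩
    obtain ⟨N, hN⟩ := hR x (M + ⌈r⌉₊)
    obtain ⟨N', hN'⟩ := hS x (⌈r⌉₊ + M)
    have hle : ∀ {y z : V}, ddist y z ≤ r → Within y z ⌈r⌉₊ := fun h =>
      h.trans (by exact_mod_cast Nat.le_ceil r)
    obtain ⟨i, hi, j, hj, hc⟩ := hM (N + N')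
    obtain ⟨n, hn, p, hp, hp0, hpn⟩ := within_iff.mp hc
    refine ⟨n, p, hp, hn, ⟨i, hp0.symm⟩, ⟨j, hpn.symm⟩, fun t ht => ?_⟩
    -- Hitting the out-ball propagates forward to `S j`, hitting the in-ball backward to `R i`; both
    -- are excluded by properness.
    rintro (hb | hb)
    · refine (hN' j (by omega)).1 (((hle hb).trans (hp.within ht le_rfl)).mono ?_ |> hpn.subst
        (motive := fun z => Within x z _))
      omega
    · refine (hN i (by omega)).2 (((hp.within (Nat.zero_le t) ht).trans (hle hb)).mono ?_ |>
        hp0.subst (motive := fun z => Within z x _))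
      omega

lemma IsQuasiIsometry.exists_isCoarseEquiv {W : Type*} [Quiver W] {f : V → W}
    (hf : IsQuasiIsometry ddist ddist f) : ∃ G, IsCoarseEquiv Within Within f G := by
  obtain ⟨γ, C, hγ, hf, hd⟩ := hf
  obtain ⟨G, hG⟩ : ∃ G, G = ⌈γ⌉₊ + ⌈C⌉₊ + ⌈γ * C⌉₊ := ⟨_, rfl⟩
  have h1 : γ ≤ G := (Nat.le_ceil γ).trans (by rw [hG]; exact_mod_cast (by omega))
  have h2 : C ≤ G := (Nat.le_ceil C).trans (by rw [hG]; exact_mod_cast (by omega))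
  have h3 : γ * C ≤ G := (Nat.le_ceil (γ * C)).trans (by rw [hG]; exact_mod_cast (by omega))
  have h0 : γ ≠ 0 := (zero_lt_one.trans_le hγ).ne'
  refine ⟨G, fun {x y n} hc => ?_, fun {x y n} hc => ?_, fun y => ?_⟩
  · calc ddist (f x) (f y) ≤ γ * ddist x y + C := (hf x y).2
      _ ≤ γ * (n : ℝ≥0) + C := by gcongr; exact_mod_cast hc
      _ ≤ ((G * (n + 1) : ℕ) : ℝ≥0∞) := by
        have : γ * n + C ≤ G * (n + 1) := by rw [mul_add, mul_one]; gcongr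
        exact_mod_cast this
  · calc ddist x y = γ * (((γ⁻¹ : ℝ≥0) : ℝ≥0∞) * ddist x y) := by
          rw [← mul_assoc, ← ENNReal.coe_mul, mul_inv_cancel₀ h0, ENNReal.coe_one, one_mul]
      _ ≤ γ * (ddist (f x) (f y) + C) := by gcongr; exact (hf x y).1
      _ ≤ γ * ((n : ℝ≥0) + C) := by gcongr; exact_mod_cast hc
      _ ≤ ((G * (n + 1) : ℕ) : ℝ≥0∞) := by
        have : γ * (n + C) ≤ G * (n + 1) := by rw [mul_add, mul_add, mul_one]; gcongr
        exact_mod_cast this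
  · obtain ⟨x, hx1, hx2⟩ := hd y
    exact ⟨x, hx1.trans (by exact_mod_cast h2), hx2.trans (by exact_mod_cast h2)⟩

end Digraph

/-! ### Boundary classes and the induced map -/

section Boundary

variable {V : Type*} [Quiver V] {𝓡 : Set (ℕ → V)}

/-- What the construction of boundary maps needs of a set of rays or anti-rays. -/
structure IsRayClass (𝓡 : Set (ℕ → V)) : Prop where
  isProper : ∀ {R}, R ∈ 𝓡 → IsProper Within R
  isBased : ∀ {R}, R ∈ 𝓡 → IsBased Within R
  trans : ∀ {R S T}, R ∈ 𝓡 → S ∈ 𝓡 → T ∈ 𝓡 → FreqLE Within R S → FreqLE Within S T →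
    FreqLE Within R T

lemma isRayClass_of_subset {δ A : ℕ} (h : IsHyp (Within (V := V)) δ A)
    (h𝓡 : 𝓡 ⊆ geodesicRays V ∪ geodesicAntiRays V) : IsRayClass 𝓡 := by
  have hor : ∀ {R}, R ∈ 𝓡 → IsGeodRay Within R ∨ IsGeodRay (rev Within) R := fun hR =>
    (h𝓡 hR).imp isGeodRay_of_mem isGeodRay_of_mem_antiRays
  refine ⟨fun hR => ?_, fun hR => ?_, fun hR hS hT => FreqLE.trans h (hor hR) (hor hS) (hor hT)⟩
  · exact (hor hR).elim (fun hR => hR.isProper h) fun hR => (hR.isProper h.reverse).reverse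
  · exact (hor hR).elim (fun hR => hR.isBased) fun hR => hR.isBased.reverse

namespace IsRayClass

lemma rayLE_iff (h : IsRayClass 𝓡) {R S : ℕ → V} (hR : R ∈ 𝓡) (hS : S ∈ 𝓡) :
    RayLE R S ↔ FreqLE Within R S :=
  HypDigraph.rayLE_iff (h.isProper hR) (h.isBased hR) (h.isProper hS)

lemma rayLE_trans (h : IsRayClass 𝓡) {R S T : ℕ → V} (hR : R ∈ 𝓡) (hS : S ∈ 𝓡) (hT : T ∈ 𝓡)
    (h₁ : RayLE R S) (h₂ : RayLE S T) : RayLE R T :=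
  (h.rayLE_iff hR hT).mpr
    (h.trans hR hS hT ((h.rayLE_iff hR hS).mp h₁) ((h.rayLE_iff hS hT).mp h₂))

lemma rayEquiv_refl (h : IsRayClass 𝓡) {R : ℕ → V} (hR : R ∈ 𝓡) : RayEquiv R R := by
  have : RayLE R R := (h.rayLE_iff hR hR).mpr ⟨0, fun N => ⟨N, le_rfl, N, le_rfl, within_refl _⟩⟩
  exact ⟨this, this⟩

lemma rayEquiv_trans (h : IsRayClass 𝓡) {R S T : ℕ → V} (hR : R ∈ 𝓡) (hS : S ∈ 𝓡) (hT : T ∈ 𝓡)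
    (h₁ : RayEquiv R S) (h₂ : RayEquiv S T) : RayEquiv R T :=
  ⟨h.rayLE_trans hR hS hT h₁.1 h₂.1, h.rayLE_trans hT hS hR h₂.2 h₁.2⟩

end IsRayClass

/-- The class of a member of `𝓡`. -/
def Boundary.mk (R : ℕ → V) (hR : R ∈ 𝓡) : Boundary 𝓡 :=
  ⟨{S | S ∈ 𝓡 ∧ RayEquiv R S}, R, hR, rfl⟩

namespace Boundary

lemma mk_eq_mk (h : IsRayClass 𝓡) {R S : ℕ → V} (hR : R ∈ 𝓡) (hS : S ∈ 𝓡)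
    (hRS : RayEquiv R S) : mk R hR = mk S hS := by
  refine Subtype.ext (Set.ext fun T => and_congr_right fun hT => ⟨fun hT' => ?_, fun hT' => ?_⟩)
  · exact h.rayEquiv_trans hS hR hT hRS.symm hT'
  · exact h.rayEquiv_trans hR hS hT hRS hT'

lemma mk_le_mk (h : IsRayClass 𝓡) {R S : ℕ → V} (hR : R ∈ 𝓡) (hS : S ∈ 𝓡) :
    mk R hR ≤ mk S hS ↔ RayLE R S := by
  constructor
  · rintro ⟨R', ⟨hR', hRR'⟩, S', ⟨hS', hSS'⟩, hle⟩
    exact h.rayLE_trans hR hS' hS (h.rayLE_trans hR hR' hS' hRR'.1 hle) hSS'.2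
  · exact fun hle => ⟨R, ⟨hR, h.rayEquiv_refl hR⟩, S, ⟨hS, h.rayEquiv_refl hS⟩, hle⟩

/-- A representative of a class. -/
noncomputable def rep (η : Boundary 𝓡) : ℕ → V := η.2.choose

lemma rep_mem (η : Boundary 𝓡) : η.rep ∈ 𝓡 := η.2.choose_spec.1

lemma mk_rep (η : Boundary 𝓡) : mk η.rep η.rep_mem = η := Subtype.ext η.2.choose_spec.2.symm

lemma mem_iff {η : Boundary 𝓡} {R : ℕ → V} : R ∈ η.1 ↔ R ∈ 𝓡 ∧ RayEquiv η.rep R := by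
  conv_lhs => rw [← mk_rep η]
  rfl

lemma rep_mk (h : IsRayClass 𝓡) {R : ℕ → V} (hR : R ∈ 𝓡) : RayEquiv (mk R hR).rep R :=
  (mem_iff.mp (show R ∈ (mk R hR).1 from ⟨hR, h.rayEquiv_refl hR⟩)).2

end Boundary

/-- A quasi-isometry that maps rays near rays and reaches all rays up to bounded distance
induces an order isomorphism of boundaries. -/
theorem exists_orderIso {W : Type*} [Quiver W] {𝓢 : Set (ℕ → W)} {f : V → W} {G δ : ℕ}
    (h𝓡 : IsRayClass 𝓡) (h𝓢 : IsRayClass 𝓢) (hW : IsThin (Within (V := W)) δ)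
    (hf : IsCoarseEquiv Within Within f G)
    (hto : ∀ R ∈ 𝓡, ∃ S ∈ 𝓢, IsNear Within (f ∘ R) S)
    (hfrom : ∀ S ∈ 𝓢, ∃ R ∈ 𝓡, IsNear Within (f ∘ R) S) :
    ∃ F : Boundary 𝓡 ≃o Boundary 𝓢, IsInducedBy F f := by
  -- `f ∘ R` need not be a ray; being proper and based is all that `rayLE_iff` asks of it.
  have hpr : ∀ {R}, R ∈ 𝓡 → IsProper Within (f ∘ R) := fun hR => hf.isProper hW (h𝓡.isProper hR)
  have hba : ∀ {R}, R ∈ 𝓡 → IsBased Within (f ∘ R) := fun hR => hf.isBased (h𝓡.isBased hR)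
  have hle : ∀ {R R' S S'}, R ∈ 𝓡 → R' ∈ 𝓡 → S ∈ 𝓢 → S' ∈ 𝓢 → IsNear Within (f ∘ R) S →
      IsNear Within (f ∘ R') S' → (RayLE S S' ↔ RayLE R R') := by
    intro R R' S S' hR hR' hS hS' hn hn'
    rw [h𝓢.rayLE_iff hS hS', h𝓡.rayLE_iff hR hR', ← hf.freqLE_iff,
      hn.freqLE_left hW (hpr hR'), hn'.freqLE_right hW (h𝓢.isProper hS)]
  have heq : ∀ {R S T}, R ∈ 𝓡 → S ∈ 𝓢 → T ∈ 𝓢 → IsNear Within (f ∘ R) S →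
      (RayEquiv (f ∘ R) T ↔ RayEquiv S T) := by
    intro R S T hR hS hT hn
    rw [RayEquiv, RayEquiv, h𝓢.rayLE_iff hS hT, h𝓢.rayLE_iff hT hS,
      rayLE_iff (hpr hR) (hba hR) (h𝓢.isProper hT),
      rayLE_iff (h𝓢.isProper hT) (h𝓢.isBased hT) (hpr hR),
      hn.freqLE_left hW (h𝓢.isProper hT), hn.freqLE_right hW (h𝓢.isProper hT)]
  choose g hg hgn using hto
  have hmap : ∀ η μ : Boundary 𝓡, Boundary.mk (g _ η.rep_mem) (hg _ η.rep_mem) ≤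
      Boundary.mk (g _ μ.rep_mem) (hg _ μ.rep_mem) ↔ η ≤ μ := by
    intro η μ
    rw [Boundary.mk_le_mk h𝓢, hle η.rep_mem μ.rep_mem (hg _ η.rep_mem) (hg _ μ.rep_mem)
      (hgn _ η.rep_mem) (hgn _ μ.rep_mem), ← Boundary.mk_le_mk h𝓡 η.rep_mem μ.rep_mem,
      η.mk_rep, μ.mk_rep]
  have hanti : ∀ η μ : Boundary 𝓡, η ≤ μ → μ ≤ η → η = μ := by
    intro η μ h1 h2
    rw [← η.mk_rep, ← μ.mk_rep] at h1 h2 ⊢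
    rw [Boundary.mk_le_mk h𝓡] at h1 h2
    exact Boundary.mk_eq_mk h𝓡 _ _ ⟨h1, h2⟩
  have hrefl : ∀ μ : Boundary 𝓢, μ ≤ μ := by
    intro μ
    rw [← μ.mk_rep, Boundary.mk_le_mk h𝓢]
    exact (h𝓢.rayEquiv_refl μ.rep_mem).1
  let F : Boundary 𝓡 → Boundary 𝓢 := fun η => Boundary.mk (g _ η.rep_mem) (hg _ η.rep_mem)
  have hbij : Function.Bijective F := by
    constructor
    · intro η μ he
      have h1 : F η ≤ F μ := he ▸ hrefl (F η)
      have h2 : F μ ≤ F η := he ▸ hrefl (F η)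
      exact hanti η μ ((hmap η μ).mp h1) ((hmap μ η).mp h2)
    · intro μ
      obtain ⟨R, hR, hn⟩ := hfrom μ.rep μ.rep_mem
      set η := Boundary.mk R hR
      have hη : RayEquiv η.rep R := Boundary.rep_mk h𝓡 hR
      refine ⟨η, ?_⟩
      rw [← μ.mk_rep]
      exact Boundary.mk_eq_mk h𝓢 _ _
        ⟨(hle η.rep_mem hR (hg _ η.rep_mem) μ.rep_mem (hgn _ η.rep_mem) hn).mpr hη.1,
          (hle hR η.rep_mem μ.rep_mem (hg _ η.rep_mem) hn (hgn _ η.rep_mem)).mpr hη.2⟩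
  refine ⟨⟨Equiv.ofBijective F hbij, fun {η μ} => hmap η μ⟩, fun η R hR => ?_⟩
  obtain ⟨hR, hη⟩ := Boundary.mem_iff.mp hR
  -- The image class does not depend on the representative, so it can be computed from the given
  -- `R`.
  have hgg : RayEquiv (g _ η.rep_mem) (g _ hR) :=
    ⟨(hle η.rep_mem hR (hg _ η.rep_mem) (hg _ hR) (hgn _ η.rep_mem) (hgn _ hR)).mpr hη.1,
      (hle hR η.rep_mem (hg _ hR) (hg _ η.rep_mem) (hgn _ hR) (hgn _ η.rep_mem)).mpr hη.2⟩
  have hF : F η = Boundary.mk (g _ hR) (hg _ hR) := Boundary.mk_eq_mk h𝓢 _ _ hgg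
  change (F η).1 = _
  rw [hF]
  exact Set.ext fun T => and_congr_right fun hT => (heq hR (hg _ hR) hT (hgn _ hR)).symm

end Boundary

end HypDigraph

/-! ### The three boundary isomorphisms -/

theorem mainTheorem3 {V₁ V₂ : Type*} [Quiver V₁] [Quiver V₂]
    (hyp₁ : HypDigraph.IsHyperbolic V₁) (hyp₂ : HypDigraph.IsHyperbolic V₂)
    (hB1₁ : HypDigraph.B1 (HypDigraph.ddist (V := V₁)))
    (hB2₁ : HypDigraph.B2 (HypDigraph.ddist (V := V₁)))
    (hB1₂ : HypDigraph.B1 (HypDigraph.ddist (V := V₂)))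
    (hB2₂ : HypDigraph.B2 (HypDigraph.ddist (V := V₂)))
    (f : V₁ → V₂)
    (hf : HypDigraph.IsQuasiIsometry HypDigraph.ddist HypDigraph.ddist f) :
    (HypDigraph.FiniteOutDegree V₁ → HypDigraph.FiniteOutDegree V₂ →
      ∃ F : HypDigraph.GeodesicFBoundary V₁ ≃o HypDigraph.GeodesicFBoundary V₂,
        HypDigraph.IsInducedBy F f) ∧
    (HypDigraph.FiniteInDegree V₁ → HypDigraph.FiniteInDegree V₂ →
      ∃ F : HypDigraph.GeodesicBBoundary V₁ ≃o HypDigraph.GeodesicBBoundary V₂,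
        HypDigraph.IsInducedBy F f) ∧
    (HypDigraph.IsLocallyFinite V₁ → HypDigraph.IsLocallyFinite V₂ →
      ∃ F : HypDigraph.GeodesicBoundary V₁ ≃o HypDigraph.GeodesicBoundary V₂,
        HypDigraph.IsInducedBy F f) := by
  open HypDigraph in
  obtain ⟨δ₁, A₁, h₁⟩ := hyp₁.exists_isHyp hB1₁ hB2₁
  obtain ⟨δ₂, A₂, h₂⟩ := hyp₂.exists_isHyp hB1₂ hB2₂
  obtain ⟨G, hG⟩ := hf.exists_isCoarseEquiv
  have toRay : FiniteOutDegree V₂ → ∀ R ∈ geodesicRays V₁, ∃ S ∈ geodesicRays V₂,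
      IsNear Within (f ∘ R) S := fun hfin R hR => by
    obtain ⟨S, hS, hn⟩ := hG.exists_ray_isNear h₂ hfin.finite (isGeodRay_of_mem hR)
    exact ⟨S, hS.mem_geodesicRays, hn⟩
  have fromRay : FiniteOutDegree V₁ → ∀ S ∈ geodesicRays V₂, ∃ R ∈ geodesicRays V₁,
      IsNear Within (f ∘ R) S := fun hfin S hS => by
    obtain ⟨R, hR, hn⟩ := hG.exists_ray_image_isNear h₁ h₂.toIsThin hfin.finite
      (isGeodRay_of_mem hS)
    exact ⟨R, hR.mem_geodesicRays, hn⟩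
  have toAntiRay : FiniteInDegree V₂ → ∀ R ∈ geodesicAntiRays V₁, ∃ S ∈ geodesicAntiRays V₂,
      IsNear Within (f ∘ R) S := fun hfin R hR => by
    obtain ⟨S, hS, hn⟩ := hG.reverse.exists_ray_isNear h₂.reverse hfin.finite
      (isGeodRay_of_mem_antiRays hR)
    exact ⟨S, hS.mem_geodesicAntiRays, hn.reverse⟩
  have fromAntiRay : FiniteInDegree V₁ → ∀ S ∈ geodesicAntiRays V₂, ∃ R ∈ geodesicAntiRays V₁,
      IsNear Within (f ∘ R) S := fun hfin S hS => by
    obtain ⟨R, hR, hn⟩ := hG.reverse.exists_ray_image_isNear h₁.reverse h₂.toIsThin.reverse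
      hfin.finite (isGeodRay_of_mem_antiRays hS)
    exact ⟨R, hR.mem_geodesicAntiRays, hn.reverse⟩
  refine ⟨fun hf₁ hf₂ => ?_, fun hf₁ hf₂ => ?_, fun hf₁ hf₂ => ?_⟩
  · exact exists_orderIso (isRayClass_of_subset h₁ Set.subset_union_left)
      (isRayClass_of_subset h₂ Set.subset_union_left) h₂.toIsThin hG (toRay hf₂) (fromRay hf₁)
  · exact exists_orderIso (isRayClass_of_subset h₁ Set.subset_union_right)
      (isRayClass_of_subset h₂ Set.subset_union_right) h₂.toIsThin hG (toAntiRay hf₂)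
      (fromAntiRay hf₁)
  · refine exists_orderIso (isRayClass_of_subset h₁ subset_rfl) (isRayClass_of_subset h₂ subset_rfl)
      h₂.toIsThin hG (fun R hR => ?_) fun S hS => ?_
    · rcases hR with hR | hR
      · exact (toRay hf₂.1 R hR).imp fun S hS => ⟨Or.inl hS.1, hS.2⟩
      · exact (toAntiRay hf₂.2 R hR).imp fun S hS => ⟨Or.inr hS.1, hS.2⟩
    · rcases hS with hS | hS
      · exact (fromRay hf₁.1 S hS).imp fun R hR => ⟨Or.inl hR.1, hR.2⟩
      · exact (fromAntiRay hf₁.2 S hS).imp fun R hR => ⟨Or.inr hR.1, hR.2⟩
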